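/- **Setting.** Let $k=(k_1,\dots,k_m)$ be a tuple of positive integers, $n=k_1+\dots+k_m$, and write $z\in\mathbb C^n=\mathbb C^{k_1}\times\dots\times\mathbb C^{k_m}$ as $z=(z_{(1)},\dots,z_{(m)})$ with $z_{(j)}=(z_{j,1},\dots,z_{j,k_j})$. For $\lambda>-1$ let $\mathcal A^2_\lambda(\mathbb B^n)$ be the weighted Bergman space of the unit ball $\mathbb B^n$, i.e. the closed subspace of analytic functions in $L_2(\mathbb B^n,dv_\lambda)$, $dv_\lambda(z)=\frac{\Gamma(n+\lambda+1)}{\pi^n\Gamma(\lambda+1)}(1-|z|^2)^\lambda dv(z)$, where $dv$ is Lebesgue measure; write $\mathcal A^2=\mathcal A^2_0$. For a bounded measurable $\varphi$ the Toeplitz operator is $T_\varphi f=B(\varphi f)$, where $B$ is the orthogonal projection onto the Bergman space. For each $j$ let $c_j=c_j(s,t)$ be a bounded measurable function on $S_+^{k_j-1}\times\mathbb T^{k_j}$, where $S_+^{k_j-1}$ is the set of vectors with non-negative entries in the unit sphere of $\mathbb R^{k_j}$, such that $c_j(s,gt_1,\dots,gt_{k_j})=c_j(s,t_1,\dots,t_{k_j})$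 for all $g\in\mathbb T$. Regard $c_j$ as a function on $\mathbb B^n$ (and on $\mathbb B^{k_j}$) through $z_{j,l}=r_js_lt_l$, $r_j=|z_{(j)}|$. Let $T_{c_j}$ be the Toeplitz operator with symbol $c_j$ on $\mathcal A^2_\lambda(\mathbb B^n)$ and $\boldsymbol{T_j}$ the one on $\mathcal A^2(\mathbb B^{k_j})$. Let $\boldsymbol H^{(j)}_d\subset\mathcal A^2(\mathbb B^{k_j})$ be the span of the monomials of degree $d$. Assume that for every $j$ and every $\zeta$ in the essential spectrum of $\boldsymbol{T_j}$ (the set of $\zeta$ for which $\boldsymbol{T_j}-\zeta I$ is not Fredholm) there are unit vectors $g_d\in\boldsymbol H^{(j)}_d$, $d=0,1,2,\dots$, with $\lim_{d\to\infty}\|(\boldsymbol{T_j}-\zeta I)g_d\|=0$. Let $\mathcal T_j$ be the unital Banach algebra (norm-closed algebra of operators on $\mathcal A^2_\lambda(\mathbb B^n)$) generated by $T_{c_j}$, and $\mathcal T(c_1,\dots,c_m)$ the unital Banach algebra generated by $\mathcal T_1,\dots,\mathcal T_m$. Write $M(\cdot)$ for the maximal ideal space, i.e. the space of non-zero multiplicative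 functionals with the Gelfand (weak-$*$) topology, and $\widehat S$ for the polynomially convex hull of a bounded set $S\subset\mathbb C$, i.e. the set of $z$ with $|p(z)|\le\sup_S|p|$ for every polynomial $p$. **Proposition.** The algebra $\mathcal T(c_1,\dots,c_m)$ is commutative and $$M(\mathcal T(c_1,\dots,c_m))=M(\mathcal T_1)\times\dots\times M(\mathcal T_m)=\widehat{\operatorname{sp}(T_{c_1})}\times\dots\times\widehat{\operatorname{sp}(T_{c_m})},$$ in the following sense: the restriction map $\psi\mapsto(\psi|_{\mathcal T_1},\dots,\psi|_{\mathcal T_m})$ is a homeomorphism of $M(\mathcal T(c_1,\dots,c_m))$ onto $M(\mathcal T_1)\times\dots\times M(\mathcal T_m)$; for each $j$ the map $\psi\mapsto\psi(T_{c_j})$ is a homeomorphism of $M(\mathcal T_j)$ onto $\widehat{\operatorname{sp}(T_{c_j})}$; and $\psi\mapsto(\psi(T_{c_1}),\dots,\psi(T_{c_m}))$ is a homeomorphism of $M(\mathcal T(c_1,\dots,c_m))$ onto $\widehat{\operatorname{sp}(T_{c_1})}\times\dots\times\widehat{\operatorname{sp}(T_{c_m})}$. -/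

import Mathlib

open MeasureTheory Filter Topology
open scoped ENNReal

namespace BergmanToeplitz

section Space

variable {ι : Type} [Fintype ι]

theorem setIntegral_rotate (g : (ι → ℂ) → ℂ) (w : ι → ℂ) (r : ℝ) (a : Circle) :
    ∫ u in Metric.closedBall (0 : ι → ℂ) r, g (w + (a : ℂ) • u)
      = ∫ u in Metric.closedBall (0 : ι → ℂ) r, g (w + u) := by
  have hmp : MeasurePreserving (fun u : ι → ℂ => fun i => (rotation a) (u i)) volume volume :=
    volume_preserving_pi (fun _ => (rotation a).measurePreserving)
  have he : MeasurableEmbedding (fun u : ι → ℂ => fun i => (rotation a) (u i)) :=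
    (Homeomorph.piCongrRight (fun _ : ι => (rotation a).toHomeomorph)).measurableEmbedding
  have h := hmp.setIntegral_preimage_emb he (fun u => g (w + u)) (Metric.closedBall 0 r)
  have hpre : (fun u : ι → ℂ => fun i => (rotation a) (u i)) ⁻¹' Metric.closedBall 0 r
      = Metric.closedBall 0 r := by
    ext u
    simp only [Set.mem_preimage, mem_closedBall_zero_iff]
    have ha : ‖(a : ℂ)‖₊ = 1 := by ext; exact Circle.norm_coe a
    have : ‖fun i => (rotation a) (u i)‖ = ‖u‖ := by
      simp [Pi.norm_def, ha]
    rw [this]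
  rw [hpre] at h
  rw [← h]
  rfl

theorem setIntegral_closedBall_eq {U : Set (ι → ℂ)} (hU : IsOpen U) {g : (ι → ℂ) → ℂ}
    (hg : DifferentiableOn ℂ g U) {w : ι → ℂ} {r : ℝ}
    (hr : Metric.closedBall w r ⊆ U) :
    ∫ u in Metric.closedBall (0 : ι → ℂ) r, g (w + u)
      = (volume.real (Metric.closedBall (0 : ι → ℂ) r) : ℂ) * g w := by
  have hmem : ∀ u ∈ Metric.closedBall (0 : ι → ℂ) r, ∀ s : ℂ, ‖s‖ ≤ 1 → w + s • u ∈ U := by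
    intro u hu s hs
    apply hr
    rw [mem_closedBall_zero_iff] at hu
    rw [mem_closedBall_iff_norm, add_sub_cancel_left, norm_smul]
    calc ‖s‖ * ‖u‖ ≤ 1 * ‖u‖ := by gcongr
      _ ≤ r := by simpa using hu
  have hmean : ∀ u ∈ Metric.closedBall (0 : ι → ℂ) r,
      ∫ θ in Set.Ioc 0 (2 * Real.pi), g (w + (circleMap 0 1 θ) • u) = (2 * Real.pi : ℂ) * g w := by
    intro u hu
    have hd : DiffContOnCl ℂ (fun s : ℂ => g (w + s • u)) (Metric.ball 0 |1|) := by
      apply DifferentiableOn.diffContOnCl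
      rw [closure_ball _ (by simp)]
      intro s hs
      have hs' : ‖s‖ ≤ 1 := by simpa using hs
      have h1 : DifferentiableAt ℂ g (w + s • u) :=
        hg.differentiableAt (hU.mem_nhds (hmem u hu s hs'))
      exact (h1.comp s (by fun_prop : DifferentiableAt ℂ (fun s : ℂ => w + s • u) s)).differentiableWithinAt
    have h := hd.circleAverage
    rw [Real.circleAverage_def, intervalIntegral.integral_of_le (by positivity)] at h
    simp only [zero_smul, add_zero, Complex.real_smul] at h
    rw [← h]
    have : (Real.pi : ℂ) ≠ 0 := by exact_mod_cast Real.pi_ne_zero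
    push_cast
    field_simp
  have hint : IntegrableOn (fun p : ℝ × (ι → ℂ) => g (w + (circleMap 0 1 p.1) • p.2))
      (Set.Ioc 0 (2 * Real.pi) ×ˢ Metric.closedBall (0 : ι → ℂ) r) (volume.prod volume) := by
    have hc : IsCompact (Set.Icc 0 (2 * Real.pi) ×ˢ Metric.closedBall (0 : ι → ℂ) r) :=
      isCompact_Icc.prod (isCompact_closedBall _ _)
    have hcont : ContinuousOn (fun p : ℝ × (ι → ℂ) => g (w + (circleMap 0 1 p.1) • p.2))
        (Set.Icc 0 (2 * Real.pi) ×ˢ Metric.closedBall (0 : ι → ℂ) r) := by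
      apply hg.continuousOn.comp
      · have := continuous_circleMap 0 1
        fun_prop
      · rintro ⟨θ, u⟩ ⟨-, hu⟩
        exact hmem u hu _ (by simp)
    refine (hcont.integrableOn_compact (μ := volume.prod volume) hc).mono_set ?_
    exact Set.prod_mono Set.Ioc_subset_Icc_self le_rfl
  have hsw := setIntegral_prod (fun p : ℝ × (ι → ℂ) => g (w + (circleMap 0 1 p.1) • p.2)) hint
  have hint2 : Integrable (fun p : ℝ × (ι → ℂ) => g (w + (circleMap 0 1 p.1) • p.2))
    ((volume.restrict (Set.Ioc 0 (2 * Real.pi))).prod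
      (volume.restrict (Metric.closedBall (0 : ι → ℂ) r))) := by
    rw [Measure.prod_restrict]; exact hint
  have hsw2 := integral_integral_swap
    (f := fun θ (u : ι → ℂ) => g (w + (circleMap 0 1 θ) • u)) hint2
  have hrot : ∀ θ : ℝ, ∫ u in Metric.closedBall (0 : ι → ℂ) r, g (w + (circleMap 0 1 θ) • u)
      = ∫ u in Metric.closedBall (0 : ι → ℂ) r, g (w + u) := by
    intro θ
    have := setIntegral_rotate g w r (Circle.exp θ)
    simpa [circleMap, Circle.coe_exp] using this
  simp_rw [hrot] at hsw2
  rw [setIntegral_congr_fun Metric.isClosed_closedBall.measurableSet hmean] at hsw2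
  simp only [integral_const, MeasurableSet.univ, measureReal_restrict_apply, Set.univ_inter,
    Real.volume_real_Ioc, sub_zero, Complex.real_smul] at hsw2
  rw [max_eq_left (by positivity)] at hsw2
  have h2 : ((2 * Real.pi : ℝ) : ℂ) ≠ 0 := by
    exact_mod_cast (by positivity : (2 * Real.pi : ℝ) ≠ 0)
  apply mul_left_cancel₀ h2
  rw [hsw2]
  push_cast
  ring

/-- The open unit ball of `ℂ^n`, `|z|² = ∑ |z_i|² < 1`, with coordinates indexed by `ι`. -/
def complexBall (ι : Type) [Fintype ι] : Set (ι → ℂ) := {z | ∑ i, ‖z i‖ ^ 2 < 1}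

/-- The normalizing constant `Γ(n + λ + 1) / (π ^ n Γ(λ + 1))`, where `n` is the size of `ι`. -/
noncomputable def bergmanConst (ι : Type) [Fintype ι] (lam : ℝ) : ℝ :=
  Real.Gamma (Fintype.card ι + lam + 1) / (Real.pi ^ Fintype.card ι * Real.Gamma (lam + 1))

/-- The measure `dv_λ(z) = c_λ (1 - |z|²) ^ λ dv(z)` on the unit ball, `dv` being Lebesgue measure. -/
noncomputable def bergmanMeasure (ι : Type) [Fintype ι] (lam : ℝ) : Measure (ι → ℂ) :=
  (volume.restrict (complexBall ι)).withDensity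
    (fun z => ENNReal.ofReal (bergmanConst ι lam * (1 - ∑ i, ‖z i‖ ^ 2) ^ lam))

theorem isOpen_complexBall : IsOpen (complexBall ι) :=
  isOpen_lt (by fun_prop) continuous_const

theorem exists_norm_le_eLpNorm {lam : ℝ} (hc : 0 < bergmanConst ι lam) {z : ι → ℂ}
    (hz : z ∈ complexBall ι) :
    ∃ r : ℝ, 0 < r ∧ Metric.ball z r ⊆ complexBall ι ∧ ∃ C : ℝ≥0∞, C ≠ ⊤ ∧
      ∀ g : (ι → ℂ) → ℂ, DifferentiableOn ℂ g (complexBall ι) → ∀ w ∈ Metric.ball z r,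
        ‖g w‖ₑ ≤ C * eLpNorm g 2 (bergmanMeasure ι lam) := by
  obtain ⟨R, hR, hRU⟩ := Metric.nhds_basis_closedBall.mem_iff.1
    (isOpen_complexBall.mem_nhds hz)
  set K := Metric.closedBall z R with hK
  have hKm : MeasurableSet K := Metric.isClosed_closedBall.measurableSet
  have hKc : IsCompact K := isCompact_closedBall _ _
  have hdens : ContinuousOn
      (fun z : ι → ℂ => bergmanConst ι lam * (1 - ∑ i, ‖z i‖ ^ 2) ^ lam) K := by
    apply ContinuousOn.mul continuousOn_const
    apply ContinuousOn.rpow_const (by fun_prop)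
    intro x hx
    left
    have : ∑ i, ‖x i‖ ^ 2 < 1 := hRU hx
    linarith
  obtain ⟨x₀, hx₀, hmin⟩ := hKc.exists_isMinOn ⟨z, Metric.mem_closedBall_self hR.le⟩ hdens
  set δ := bergmanConst ι lam * (1 - ∑ i, ‖x₀ i‖ ^ 2) ^ lam with hδ
  have hδpos : 0 < δ := by
    have : ∑ i, ‖x₀ i‖ ^ 2 < 1 := hRU hx₀
    exact mul_pos hc (Real.rpow_pos_of_pos (by linarith) _)
  have hδ0 : ENNReal.ofReal δ ≠ 0 := by simpa using hδpos
  have hle : volume.restrict K ≤ (ENNReal.ofReal δ)⁻¹ • bergmanMeasure ι lam := by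
    have h1 : (ENNReal.ofReal δ) • volume.restrict K ≤ bergmanMeasure ι lam := by
      rw [bergmanMeasure, ← withDensity_const, ← Measure.restrict_restrict_of_subset hRU]
      refine le_trans (b := ((volume.restrict (complexBall ι)).restrict K).withDensity
        (fun z => ENNReal.ofReal (bergmanConst ι lam * (1 - ∑ i, ‖z i‖ ^ 2) ^ lam))) ?_ ?_
      · apply withDensity_mono
        filter_upwards [ae_restrict_mem hKm] with x hx
        exact ENNReal.ofReal_le_ofReal (hmin hx)
      · rw [← restrict_withDensity hKm]
        exact Measure.restrict_le_self
    calc volume.restrict K = (ENNReal.ofReal δ)⁻¹ • ((ENNReal.ofReal δ) • volume.restrict K) := by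
          rw [smul_smul, ENNReal.inv_mul_cancel hδ0 ENNReal.ofReal_ne_top, one_smul]
      _ ≤ _ := by gcongr
  set V := volume (Metric.closedBall (0 : ι → ℂ) (R / 2)) with hV
  have hVpos : V ≠ 0 := (Metric.measure_closedBall_pos _ _ (by positivity)).ne'
  have hVtop : V ≠ ⊤ := measure_closedBall_lt_top.ne
  have hKtop : volume K ≠ ⊤ := measure_closedBall_lt_top.ne
  refine ⟨R / 2, by positivity,
    (Metric.ball_subset_closedBall.trans (Metric.closedBall_subset_closedBall (by linarith))).trans
      hRU, V⁻¹ * (((ENNReal.ofReal δ)⁻¹) ^ (1 / (2 : ℝ≥0∞)).toReal * volume K ^ (1 / 2 : ℝ)), ?_, ?_⟩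
  · have : (ENNReal.ofReal δ)⁻¹ ≠ ⊤ := by simpa using hδpos
    have h1 : ((ENNReal.ofReal δ)⁻¹) ^ (1 / (2 : ℝ≥0∞)).toReal ≠ ⊤ :=
      ENNReal.rpow_ne_top_of_nonneg (by positivity) this
    have h2 : volume K ^ (1 / 2 : ℝ) ≠ ⊤ := ENNReal.rpow_ne_top_of_nonneg (by positivity) hKtop
    exact ENNReal.mul_ne_top (ENNReal.inv_ne_top.2 hVpos) (ENNReal.mul_ne_top h1 h2)
  intro g hg w hw
  have hwK : Metric.closedBall w (R / 2) ⊆ K := by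
    apply Metric.closedBall_subset_closedBall'
    have := Metric.mem_ball.1 hw
    linarith
  have hmv := setIntegral_closedBall_eq isOpen_complexBall hg (hwK.trans hRU)
  have hcont : ContinuousOn g K := hg.continuousOn.mono hRU
  have hgm : AEStronglyMeasurable g (volume.restrict K) := hcont.aestronglyMeasurable hKm
  have h1 : V * ‖g w‖ₑ ≤ eLpNorm g 1 (volume.restrict K) := by
    have e1 : V * ‖g w‖ₑ = ‖∫ u in Metric.closedBall (0 : ι → ℂ) (R / 2), g (w + u)‖ₑ := by
      rw [hmv, enorm_mul]
      congr 1
      rw [← ofReal_norm, Complex.norm_real, Real.norm_of_nonneg measureReal_nonneg, Measure.real,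
        ENNReal.ofReal_toReal hVtop]
    rw [e1]
    refine (enorm_integral_le_lintegral_enorm _).trans ?_
    have e2 : ∫⁻ u in Metric.closedBall (0 : ι → ℂ) (R / 2), ‖g (w + u)‖ₑ
        = ∫⁻ u in Metric.closedBall w (R / 2), ‖g u‖ₑ := by
      have := (measurePreserving_add_left (volume : Measure (ι → ℂ)) w).setLIntegral_comp_preimage_emb
        (measurableEmbedding_addLeft w) (fun u => ‖g u‖ₑ) (Metric.closedBall w (R / 2))
      rw [← this]
      congr 2
      ext u
      simp
    rw [e2, eLpNorm_one_eq_lintegral_enorm]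
    exact lintegral_mono' (Measure.restrict_mono hwK le_rfl) le_rfl
  have h2 : eLpNorm g 1 (volume.restrict K)
      ≤ eLpNorm g 2 (volume.restrict K) * volume K ^ (1 / 2 : ℝ) := by
    have := eLpNorm_le_eLpNorm_mul_rpow_measure_univ (p := 1) (q := 2) (by norm_num) hgm
    convert this using 2
    rw [Measure.restrict_apply_univ]
    norm_num
  have h3 : eLpNorm g 2 (volume.restrict K)
      ≤ ((ENNReal.ofReal δ)⁻¹) ^ (1 / (2 : ℝ≥0∞)).toReal * eLpNorm g 2 (bergmanMeasure ι lam) := by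
    refine (eLpNorm_mono_measure g hle).trans ?_
    rw [eLpNorm_smul_measure_of_ne_top (by norm_num)]
    simp
  calc ‖g w‖ₑ = V⁻¹ * (V * ‖g w‖ₑ) := by
        rw [← mul_assoc, ENNReal.inv_mul_cancel hVpos hVtop, one_mul]
    _ ≤ V⁻¹ * ((((ENNReal.ofReal δ)⁻¹) ^ (1 / (2 : ℝ≥0∞)).toReal
          * eLpNorm g 2 (bergmanMeasure ι lam)) * volume K ^ (1 / 2 : ℝ)) := by
        exact mul_le_mul_right (h1.trans (h2.trans (mul_le_mul_left h3 _))) _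
    _ = _ := by ring

/-- The weighted Bergman space: the (classes of) functions of `L²(dv_λ)` that are analytic
on the unit ball. -/
noncomputable def bergmanSpace (ι : Type) [Fintype ι] (lam : ℝ) : Submodule ℂ (Lp ℂ 2 (bergmanMeasure ι lam)) where
  carrier := {f | ∃ g : (ι → ℂ) → ℂ, DifferentiableOn ℂ g (complexBall ι) ∧
    f =ᵐ[bergmanMeasure ι lam] g}
  zero_mem' := ⟨0, differentiableOn_const 0, Lp.coeFn_zero ℂ 2 _⟩
  add_mem' := by
    rintro f₁ f₂ ⟨g₁, h₁, e₁⟩ ⟨g₂, h₂, e₂⟩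
    exact ⟨g₁ + g₂, h₁.add h₂, (Lp.coeFn_add f₁ f₂).trans (e₁.add e₂)⟩
  smul_mem' := by
    rintro a f ⟨g, h, e⟩
    exact ⟨a • g, h.const_smul a, (Lp.coeFn_smul a f).trans (e.const_smul a)⟩

theorem isClosed_bergmanSpace (lam : ℝ) :
    IsClosed (bergmanSpace ι lam : Set (Lp ℂ 2 (bergmanMeasure ι lam))) := by
  rcases le_or_gt (bergmanConst ι lam) 0 with hc | hc
  · have hμ : bergmanMeasure ι lam = 0 := by
      have hm : MeasurableSet (complexBall ι) := isOpen_complexBall.measurableSet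
      rw [bergmanMeasure]
      refine (withDensity_congr_ae (g := 0) ?_).trans withDensity_zero
      filter_upwards [ae_restrict_mem hm] with x hx
      have : ∑ i, ‖x i‖ ^ 2 < 1 := hx
      simp only [Pi.zero_apply, ENNReal.ofReal_eq_zero]
      exact mul_nonpos_of_nonpos_of_nonneg hc (Real.rpow_nonneg (by linarith) _)
    convert isClosed_univ
    refine Set.eq_univ_of_forall fun f => ⟨0, differentiableOn_const 0, ?_⟩
    have h0 : ae (bergmanMeasure ι lam) = ⊥ := by rw [hμ, ae_zero]
    rw [Filter.EventuallyEq, h0]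
    exact eventually_bot
  apply IsSeqClosed.isClosed
  intro f F hf hF
  choose g hg hfg using hf
  have hcauchy := hF.cauchySeq
  have key : ∀ z ∈ complexBall ι, ∃ r : ℝ, 0 < r ∧ Metric.ball z r ⊆ complexBall ι ∧
      ∃ C : ℝ, 0 ≤ C ∧ ∀ n m, ∀ w ∈ Metric.ball z r, ‖g n w - g m w‖ ≤ C * dist (f n) (f m) := by
    intro z hz
    obtain ⟨r, hr, hrU, C, hC, h⟩ := exists_norm_le_eLpNorm hc hz
    refine ⟨r, hr, hrU, C.toReal, ENNReal.toReal_nonneg, fun n m w hw => ?_⟩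
    have h1 := h (g n - g m) ((hg n).sub (hg m)) w hw
    have h2 : eLpNorm (g n - g m) 2 (bergmanMeasure ι lam) = edist (f n) (f m) := by
      rw [Lp.edist_def]
      exact eLpNorm_congr_ae ((hfg n).sub (hfg m)).symm
    rw [h2] at h1
    have h3 := ENNReal.toReal_mono (ENNReal.mul_ne_top hC (edist_ne_top _ _)) h1
    simpa [ENNReal.toReal_mul, edist_dist] using h3
  have hpt : ∀ z ∈ complexBall ι, ∃ y, Tendsto (fun n => g n z) atTop (𝓝 y) := by
    intro z hz
    obtain ⟨r, hr, hrU, C, hC, h⟩ := key z hz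
    apply cauchySeq_tendsto_of_complete
    rw [Metric.cauchySeq_iff] at hcauchy ⊢
    intro ε hε
    obtain ⟨N, hN⟩ := hcauchy (ε / (C + 1)) (by positivity)
    refine ⟨N, fun n hn m hm => ?_⟩
    rw [dist_eq_norm]
    have h1 := h n m z (Metric.mem_ball_self hr)
    have h2 := hN n hn m hm
    rw [lt_div_iff₀ (by positivity)] at h2
    nlinarith [dist_nonneg (x := f n) (y := f m)]
  have keyd : ∀ z ∈ complexBall ι, ∃ r : ℝ, 0 < r ∧ ∃ C : ℝ, 0 ≤ C ∧
      ∀ n m, ∀ w ∈ Metric.ball z r, ‖fderiv ℂ (g n) w - fderiv ℂ (g m) w‖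
        ≤ C * dist (f n) (f m) := by
    intro z hz
    obtain ⟨r, hr, hrU, C, hC, h⟩ := key z hz
    refine ⟨r / 2, by positivity, 2 * C / (r / 2), by positivity, fun n m w hw => ?_⟩
    have hsub : Metric.ball w (r / 2) ⊆ Metric.ball z r := by
      apply Metric.ball_subset_ball'
      have := Metric.mem_ball.1 hw
      linarith
    have hwU : w ∈ complexBall ι := hrU (hsub (Metric.mem_ball_self (by positivity)))
    have hdn : ∀ n, DifferentiableAt ℂ (g n) w :=
      fun n => (hg n).differentiableAt (isOpen_complexBall.mem_nhds hwU)
    rw [← fderiv_sub (hdn n) (hdn m)]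
    have := Complex.norm_fderiv_le_div_of_mapsTo_ball (f := g n - g m) (c := w)
      (R₁ := r / 2) (R₂ := 2 * C * dist (f n) (f m))
      (((hg n).sub (hg m)).mono (hsub.trans hrU)) ?_ (by positivity)
    · refine this.trans (le_of_eq ?_)
      ring
    · intro x hx
      rw [mem_closedBall_iff_norm]
      have h1 := h n m x (hsub hx)
      have h2 := h n m w (hsub (Metric.mem_ball_self (by positivity)))
      refine (norm_sub_le _ _).trans ?_
      simp only [Pi.sub_apply]
      linarith
  have hptd : ∀ z ∈ complexBall ι, ∃ y, Tendsto (fun n => fderiv ℂ (g n) z) atTop (𝓝 y) := by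
    intro z hz
    obtain ⟨r, hr, C, hC, h⟩ := keyd z hz
    apply cauchySeq_tendsto_of_complete
    rw [Metric.cauchySeq_iff] at hcauchy ⊢
    intro ε hε
    obtain ⟨N, hN⟩ := hcauchy (ε / (C + 1)) (by positivity)
    refine ⟨N, fun n hn m hm => ?_⟩
    rw [dist_eq_norm]
    have h1 := h n m z (Metric.mem_ball_self hr)
    have h2 := hN n hn m hm
    rw [lt_div_iff₀ (by positivity)] at h2
    nlinarith [dist_nonneg (x := f n) (y := f m)]
  classical
  choose! G hG using hpt
  choose! G' hG' using hptd
  have hunif : TendstoLocallyUniformlyOn (fun n => fderiv ℂ (g n)) G' atTop (complexBall ι) := by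
    rw [Metric.tendstoLocallyUniformlyOn_iff]
    intro ε hε z hz
    obtain ⟨r, hr, C, hC, h⟩ := keyd z hz
    refine ⟨Metric.ball z r ∩ complexBall ι, inter_mem (mem_nhdsWithin_of_mem_nhds (Metric.ball_mem_nhds z hr)) self_mem_nhdsWithin, ?_⟩
    rw [Metric.cauchySeq_iff] at hcauchy
    obtain ⟨N, hN⟩ := hcauchy (ε / (2 * (C + 1))) (by positivity)
    filter_upwards [eventually_ge_atTop N] with n hn w hw
    have hb : ∀ m ≥ N, dist (fderiv ℂ (g m) w) (fderiv ℂ (g n) w) ≤ ε / 2 := by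
      intro m hm
      rw [dist_eq_norm]
      have h1 := h m n w hw.1
      have h2 := hN m hm n hn
      rw [lt_div_iff₀ (by positivity)] at h2
      nlinarith [dist_nonneg (x := f m) (y := f n)]
    have := le_of_tendsto ((hG' w hw.2).dist tendsto_const_nhds)
      (eventually_atTop.2 ⟨N, hb⟩)
    linarith
  have hGdiff : DifferentiableOn ℂ G (complexBall ι) := by
    intro z hz
    exact (hasFDerivAt_of_tendstoLocallyUniformlyOn isOpen_complexBall hunif
      (fun n x hx => ((hg n).differentiableAt (isOpen_complexBall.mem_nhds hx)).hasFDerivAt)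
      hG hz).differentiableAt.differentiableWithinAt
  refine ⟨G, hGdiff, ?_⟩
  obtain ⟨ns, hns, hlim⟩ := (tendstoInMeasure_of_tendsto_Lp hF).exists_seq_tendsto_ae
  have hball : ∀ᵐ x ∂bergmanMeasure ι lam, x ∈ complexBall ι :=
    (withDensity_absolutelyContinuous _ _).ae_le
      (ae_restrict_mem isOpen_complexBall.measurableSet)
  filter_upwards [hlim, hball, ae_all_iff.2 hfg] with x hx hxB hfx
  refine tendsto_nhds_unique hx ?_
  simp_rw [hfx]
  exact (hG x hxB).comp hns.tendsto_atTop

/-- The Bergman space is closed in `L²(dv_λ)`, hence complete. -/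
instance instCompleteSpaceBergman (lam : ℝ) : CompleteSpace (bergmanSpace ι lam) :=
  (isClosed_bergmanSpace lam).completeSpace_coe

/-- The Toeplitz operator `T_φ f = B_λ (φ f)` on the Bergman space, `B_λ` being the orthogonal
projection of `L²(dv_λ)` onto it and `φ` an element of `L^∞`. -/
noncomputable def toeplitz {lam : ℝ} (φ : Lp ℂ ∞ (bergmanMeasure ι lam)) :
    bergmanSpace ι lam →L[ℂ] bergmanSpace ι lam :=
  (bergmanSpace ι lam).orthogonalProjectionOnto ∘L
    ((ContinuousLinearMap.mul ℂ ℂ).holderL (bergmanMeasure ι lam) ∞ 2 2 φ) ∘L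
      (bergmanSpace ι lam).subtypeL

/-- The normalized monomial
`e_α(z) = √(Γ(n + |α| + λ + 1) / (α! Γ(n + λ + 1))) z ^ α`. -/
noncomputable def monomialFun (lam : ℝ) (α : ι → ℕ) (z : ι → ℂ) : ℂ :=
  (√(Real.Gamma (Fintype.card ι + (∑ i, α i : ℕ) + lam + 1) /
    ((∏ i, (α i).factorial : ℕ) * Real.Gamma (Fintype.card ι + lam + 1))) : ℝ) *
    ∏ i, z i ^ α i

/-- The span of the normalized monomials `e_α` with `|α| = d` in the Bergman space. -/
noncomputable def homogeneousSubspace (ι : Type) [Fintype ι] (lam : ℝ) (d : ℕ) :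
    Submodule ℂ (bergmanSpace ι lam) :=
  Submodule.span ℂ {f | ∃ α : ι → ℕ, ∑ i, α i = d ∧
    (f : Lp ℂ 2 (bergmanMeasure ι lam)) =ᵐ[bergmanMeasure ι lam] monomialFun lam α}

end Space

section Symbols

/-- The circle group carries its Borel sigma-algebra. -/
noncomputable instance instMeasurableSpaceCircle : MeasurableSpace Circle := borel Circle

instance instBorelSpaceCircle : BorelSpace Circle := ⟨rfl⟩

/-- The elements of the unit sphere of `ℝ^k` with non-negative entries. -/
abbrev SpherePos (k : ℕ) : Type := {s : Fin k → ℝ // (∀ l, 0 ≤ s l) ∧ ∑ l, s l ^ 2 = 1}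

/-- A generalized pseudo-homogeneous symbol `c(s, t)`: a bounded measurable function of
`s ∈ S_+^{k-1}` and `t ∈ 𝕋^k`, invariant under the diagonal action of `𝕋` on `t`. -/
structure PseudoHomogeneous (k : ℕ) where
  toFun : SpherePos k → (Fin k → Circle) → ℂ
  measurable : Measurable (Function.uncurry toFun)
  bounded : ∃ C : ℝ, ∀ s t, ‖toFun s t‖ ≤ C
  invariant : ∀ s t (g : Circle), toFun s (fun l => g * t l) = toFun s t

/-- The direction `(|z_1| / r, …, |z_k| / r)` of a non-zero `z`, where `r = |z|`. -/
noncomputable def direction {k : ℕ} (z : Fin k → ℂ) (hz : z ≠ 0) : SpherePos k :=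
  ⟨fun l => ‖z l‖ / √(∑ i, ‖z i‖ ^ 2), fun l => by positivity, by
    have h0 : 0 < ∑ i, ‖z i‖ ^ 2 := by
      obtain ⟨i, hi⟩ := Function.ne_iff.1 hz
      exact Finset.sum_pos' (fun _ _ => by positivity)
        ⟨i, Finset.mem_univ i, by have := norm_pos_iff.2 hi; positivity⟩
    simp_rw [div_pow, Real.sq_sqrt h0.le]
    rw [← Finset.sum_div, div_self h0.ne']⟩

open Classical in
/-- The symbol as a function of `z ∈ ℂ^k`: `z ↦ c(s, t)` where `z_l = r s_l t_l`, `r = |z|`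
(`t_l = 1` when `z_l = 0`, and the value at the origin is `0`: these choices only concern a
null set). -/
noncomputable def PseudoHomogeneous.onSpace {k : ℕ} (c : PseudoHomogeneous k)
    (z : Fin k → ℂ) : ℂ :=
  if hz : z ∈ ({0}ᶜ : Set (Fin k → ℂ)) then
    c.toFun (direction z hz) (fun l => Circle.exp (z l).arg)
  else 0

theorem PseudoHomogeneous.measurable_onSpace {k : ℕ} (c : PseudoHomogeneous k) :
    Measurable c.onSpace := by
  classical
  have h1 : Measurable (fun z : ({0}ᶜ : Set (Fin k → ℂ)) => direction z.1 z.2) := by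
    apply Measurable.subtype_mk
    refine measurable_pi_lambda _ fun l => ?_
    have hm : ∀ i : Fin k, Measurable (fun z : ({0}ᶜ : Set (Fin k → ℂ)) => ‖z.1 i‖) := fun i =>
      ((measurable_pi_apply i).comp measurable_subtype_coe).norm
    exact (hm l).div (Finset.measurable_sum _ fun i _ => (hm i).pow_const 2).sqrt
  have h2 : Measurable (fun z : ({0}ᶜ : Set (Fin k → ℂ)) =>
      fun l => Circle.exp (z.1 l).arg) := by
    refine measurable_pi_lambda _ fun l => ?_
    exact Circle.exp.continuous.measurable.comp
      (Complex.measurable_arg.comp ((measurable_pi_apply l).comp measurable_subtype_coe))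
  exact Measurable.dite (s := ({0}ᶜ : Set (Fin k → ℂ)))
    (f := fun z => c.toFun (direction z.1 z.2) (fun l => Circle.exp (z.1 l).arg))
    (g := fun _ => 0)
    (c.measurable.comp (h1.prodMk h2)) measurable_const (measurableSet_singleton 0).compl

theorem PseudoHomogeneous.memLp_comp {ι : Type} [Fintype ι] {k : ℕ} (c : PseudoHomogeneous k)
    (lam : ℝ) (p : Fin k → ι) :
    MemLp (fun z : ι → ℂ => c.onSpace (fun l => z (p l))) ∞ (bergmanMeasure ι lam) := by
  obtain ⟨C, hC⟩ := c.bounded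
  refine memLp_top_of_bound (C := max C 0)
    (c.measurable_onSpace.comp (by fun_prop)).aestronglyMeasurable (.of_forall fun z => ?_)
  rw [PseudoHomogeneous.onSpace]
  split_ifs
  · exact (hC _ _).trans (le_max_left _ _)
  · simp

/-- The Toeplitz operator with symbol `c` on the weightless Bergman space of the unit ball
of `ℂ^k`. -/
noncomputable def PseudoHomogeneous.blockToeplitz {k : ℕ} (c : PseudoHomogeneous k) :
    bergmanSpace (Fin k) 0 →L[ℂ] bergmanSpace (Fin k) 0 :=
  toeplitz ((c.memLp_comp 0 (fun l => l)).toLp _)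

variable {m : ℕ} {k : Fin m → ℕ}

/-- The Toeplitz operator `T_{c_j}` on the weighted Bergman space of the unit ball of
`ℂ^n = ℂ^{k_1} × … × ℂ^{k_m}`, with coordinates `z_{j,l}`; its symbol is
`z ↦ c_j(z_{(j)})`. -/
noncomputable def symbolToeplitz (c : ∀ j, PseudoHomogeneous (k j)) (lam : ℝ) (j : Fin m) :
    bergmanSpace (Σ j, Fin (k j)) lam →L[ℂ] bergmanSpace (Σ j, Fin (k j)) lam :=
  toeplitz (((c j).memLp_comp lam (fun l => (⟨j, l⟩ : Σ j, Fin (k j)))).toLp _)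

end Symbols

section Algebras

/-- The essential spectrum of a bounded operator. -/
def essentialSpectrum {E : Type} [NormedAddCommGroup E] [NormedSpace ℂ E] (T : E →L[ℂ] E) :
    Set ℂ :=
  {ζ | ¬ (T - ζ • (1 : E →L[ℂ] E)).IsFredholm}

/-- The polynomially convex hull of a bounded subset `S` of `ℂ`: the points `z` with
`|p(z)| ≤ sup_S |p|` for every polynomial `p`. -/
def polyHull (S : Set ℂ) : Set ℂ :=
  {z | ∀ (p : Polynomial ℂ) (C : ℝ), (∀ w ∈ S, ‖p.eval w‖ ≤ C) → ‖p.eval z‖ ≤ C}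

/-- The unital Banach algebra generated by a set of bounded operators. -/
noncomputable def banachAlg {E : Type} [NormedAddCommGroup E] [NormedSpace ℂ E]
    (S : Set (E →L[ℂ] E)) : Subalgebra ℂ (E →L[ℂ] E) :=
  (Algebra.adjoin ℂ S).topologicalClosure

theorem subset_banachAlg {E : Type} [NormedAddCommGroup E] [NormedSpace ℂ E]
    (S : Set (E →L[ℂ] E)) : S ⊆ banachAlg S :=
  Algebra.subset_adjoin.trans (Subalgebra.le_topologicalClosure _)

variable {m : ℕ} {k : Fin m → ℕ}

/-- The unital Banach algebra `𝒯_j` generated by the single operator `T_{c_j}`. -/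
noncomputable def singleAlg (c : ∀ j, PseudoHomogeneous (k j)) (lam : ℝ) (j : Fin m) :
    Subalgebra ℂ (bergmanSpace (Σ j, Fin (k j)) lam →L[ℂ] bergmanSpace (Σ j, Fin (k j)) lam) :=
  banachAlg {symbolToeplitz c lam j}

/-- The unital Banach algebra `𝒯(c_1, …, c_m)` generated by `𝒯_1, …, 𝒯_m`. -/
noncomputable def jointAlg (c : ∀ j, PseudoHomogeneous (k j)) (lam : ℝ) :
    Subalgebra ℂ (bergmanSpace (Σ j, Fin (k j)) lam →L[ℂ] bergmanSpace (Σ j, Fin (k j)) lam) :=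
  banachAlg (⋃ j, (singleAlg c lam j : Set _))

theorem singleAlg_le_jointAlg (c : ∀ j, PseudoHomogeneous (k j)) (lam : ℝ) (j : Fin m) :
    singleAlg c lam j ≤ jointAlg c lam :=
  fun _ hT => subset_banachAlg _ (Set.mem_iUnion.2 ⟨j, hT⟩)

/-- `T_{c_j}` as an element of `𝒯_j`. -/
noncomputable def singleGen (c : ∀ j, PseudoHomogeneous (k j)) (lam : ℝ) (j : Fin m) :
    singleAlg c lam j :=
  ⟨symbolToeplitz c lam j, subset_banachAlg _ rfl⟩

/-- The maximal ideal space of a commutative unital Banach algebra: the non-zero continuous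
multiplicative functionals, with the topology of pointwise convergence. -/
abbrev maxIdealSpace (A : Type) [NormedRing A] [NormedAlgebra ℂ A] : Type :=
  WeakDual.characterSpace ℂ A

end Algebras

end BergmanToeplitz

/-!
The monomials `z ^ α` are an orthogonal basis of the Bergman space of the ball
(`eq_zero_of_forall_inner_monomialVector` gives completeness), and a multi-index is a tuple of
multi-indices, one for each group of variables. In the basis of normalized monomials the operator
`T_{c_j}` changes the exponents of the `j`-th group only, and its matrix does not involve the
exponents of the other groups. Indeed, the symbol is invariant under rotations of any variable of
another group and under joint rotations of the `j`-th group, so that the entry between two monomials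
vanishes unless the exponents outside the group and the degrees in the group agree
(`inner_symbolToeplitz_eq_zero_of_ne`, `inner_symbolToeplitz_eq_zero_of_degree_ne`). When they
agree, polar coordinates in the `j`-th group split the entry into an integral over the sphere and
a factor that also occurs in the norms of both monomials, and therefore cancels
(`inner_toeplitz_unitMonomial_eq`). So the Bergman space is a Hilbert tensor product with one
factor for each group, of which `T_{c_j}` acts on the `j`-th
(`exists_isAmpliation_symbolToeplitz`).

Operators acting on different factors commute. A point of the frontier of the spectrum of an
operator is an approximate eigenvalue, and the approximate eigenvectors of an operator acting on one
factor can be taken in that factor; tensor products of them are joint approximate eigenvectors.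
Hence `|P(ζ)| ≤ ‖P(T_{c_1}, …, T_{c_m})‖` for all polynomials `P` and all `ζ` in the product of
the frontiers of the spectra (`norm_lift_le_of_mem_frontier_spectrum`). The maximum principle, used
in one variable at a time, extends the inequality to the product of the polynomially convex hulls
(`norm_lift_le_of_mem_polyHull`), so every point there is the value of a character
(`exists_character_of_forall_norm_lift_le`). Conversely, the spectral radius formula shows that
a character maps each `T_{c_j}` into the polynomially convex hull of its spectrum
(`character_apply_mem_polyHull`). As a character is determined by its values at the generators,
evaluation at these is a homeomorphism of the compact maximal ideal space onto the product of
the hulls.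
-/

namespace BergmanToeplitz

/-! ### Characters of finitely generated commutative Banach algebras -/

section Characters

/-- In a commutative Banach algebra generated by `s`, a point `ζ` at which no noncommutative
polynomial exceeds in modulus the norm of its value at `s` is the value at `s` of a character:
otherwise the ideal generated by the `s i - ζ i` contains `1`, and replacing its coefficients
by polynomials in `s` gives a polynomial that is `1` at `ζ` and of norm less than `1` at `s`. -/
theorem exists_character_of_forall_norm_lift_le {ι A : Type*} [Finite ι] [NormedCommRing A]
    [NormedAlgebra ℂ A] [CompleteSpace A] {s : ι → A}
    (hs : Dense (Algebra.adjoin ℂ (Set.range s) : Set A)) {ζ : ι → ℂ}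
    (hζ : ∀ P : FreeAlgebra ℂ ι, ‖FreeAlgebra.lift ℂ ζ P‖ ≤ ‖FreeAlgebra.lift ℂ s P‖) :
    ∃ ψ : WeakDual.characterSpace ℂ A, ∀ i, ψ (s i) = ζ i := by
  have := Fintype.ofFinite ι
  by_cases hI : Ideal.span (Set.range fun i => s i - algebraMap ℂ A (ζ i)) = ⊤
  · exfalso
    obtain ⟨r, hr⟩ := (Ideal.mem_span_range_iff_exists_fun (R := A)).1
      ((Ideal.eq_top_iff_one _).1 hI)
    have happ : ∀ ε > 0, ∀ a : A, ∃ P : FreeAlgebra ℂ ι, ‖a - FreeAlgebra.lift ℂ s P‖ < ε := by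
      intro ε hε a
      obtain ⟨b, hb, hab⟩ := Metric.mem_closure_iff.1 (hs a) ε hε
      rw [SetLike.mem_coe, Algebra.adjoin_range_eq_range_freeAlgebra_lift] at hb
      obtain ⟨P, rfl⟩ := hb
      exact ⟨P, by rw [← dist_eq_norm]; exact hab⟩
    set K := ∑ i, ‖s i - algebraMap ℂ A (ζ i)‖ with hK
    have hK0 : 0 ≤ K := Finset.sum_nonneg fun _ _ => norm_nonneg _
    choose Q hQ using fun i => happ (1 / (K + 1)) (by positivity) (r i)
    set P : FreeAlgebra ℂ ι :=
      1 - ∑ i, Q i * (FreeAlgebra.ι ℂ i - algebraMap ℂ _ (ζ i)) with hP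
    have h1 : FreeAlgebra.lift ℂ ζ P = 1 := by
      simp [hP]
    have h2 : FreeAlgebra.lift ℂ s P
        = ∑ i, (r i - FreeAlgebra.lift ℂ s (Q i)) * (s i - algebraMap ℂ A (ζ i)) := by
      simp only [hP, map_sub, map_one, map_sum, map_mul, FreeAlgebra.lift_ι_apply,
        AlgHom.commutes, sub_mul, Finset.sum_sub_distrib]
      rw [← hr]
    have h3 : ‖FreeAlgebra.lift ℂ s P‖ < 1 := by
      rw [h2]
      calc _ ≤ ∑ i, 1 / (K + 1) * ‖s i - algebraMap ℂ A (ζ i)‖ := by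
            refine norm_sum_le_of_le _ fun i _ => (norm_mul_le _ _).trans ?_
            gcongr
            exact (hQ i).le
        _ = K / (K + 1) := by rw [← Finset.mul_sum]; ring
        _ < 1 := by rw [div_lt_one (by positivity)]; linarith
    have := hζ P
    rw [h1, norm_one] at this
    linarith
  · obtain ⟨M, hM, hIM⟩ := Ideal.exists_le_maximal _ hI
    refine ⟨M.toCharacterSpace, fun i => ?_⟩
    have h := M.toCharacterSpace_apply_eq_zero_of_mem
      (hIM (Ideal.subset_span (Set.mem_range_self i)))
    rw [map_sub, AlgHomClass.commutes, sub_eq_zero] at h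
    exact h

variable {B : Type} [NormedRing B] [NormedAlgebra ℂ B]

theorem apply_freeAlgebra_lift {ι A F C : Type*} [Semiring A] [Algebra ℂ A] [Semiring C]
    [Algebra ℂ C] [FunLike F A C] [AlgHomClass F ℂ A C] (f : F) (s : ι → A)
    (P : FreeAlgebra ℂ ι) :
    f (FreeAlgebra.lift ℂ s P) = FreeAlgebra.lift ℂ (fun i => f (s i)) P := by
  have : (AlgHomClass.toAlgHom f).comp (FreeAlgebra.lift ℂ s)
      = FreeAlgebra.lift ℂ (fun i => f (s i)) := by
    ext i; simp
  exact DFunLike.congr_fun this P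

theorem mem_of_eq_topologicalClosure {ι : Type} {s : ι → B} {A : Subalgebra ℂ B}
    (hA : A = (Algebra.adjoin ℂ (Set.range s)).topologicalClosure) (i : ι) : s i ∈ A :=
  hA ▸ Subalgebra.le_topologicalClosure _ (Algebra.subset_adjoin (Set.mem_range_self i))

theorem completeSpace_of_eq_topologicalClosure [CompleteSpace B] {S : Set B}
    {A : Subalgebra ℂ B} (hA : A = (Algebra.adjoin ℂ S).topologicalClosure) :
    CompleteSpace A := by
  subst hA
  exact (Subalgebra.isClosed_topologicalClosure _).completeSpace_coe

theorem dense_adjoin_range {ι : Type} {s : ι → B} {A : Subalgebra ℂ B}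
    (hA : A = (Algebra.adjoin ℂ (Set.range s)).topologicalClosure) :
    Dense (Algebra.adjoin ℂ
      (Set.range fun i => (⟨s i, mem_of_eq_topologicalClosure hA i⟩ : A)) : Set A) := by
  set s' : ι → A := fun i => ⟨s i, mem_of_eq_topologicalClosure hA i⟩ with hs'
  have himg : (Algebra.adjoin ℂ (Set.range s')).map A.val = Algebra.adjoin ℂ (Set.range s) := by
    rw [AlgHom.map_adjoin, ← Set.range_comp]
    rfl
  intro a
  rw [closure_subtype]
  have ha : (a : B) ∈ closure (Algebra.adjoin ℂ (Set.range s) : Set B) := by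
    have h : ∀ x ∈ A, x ∈ (Algebra.adjoin ℂ (Set.range s)).topologicalClosure :=
      fun x hx => hA ▸ hx
    exact h a a.2
  rw [← himg] at ha
  exact ha

theorem mul_comm_of_eq_topologicalClosure {ι : Type} {s : ι → B} {A : Subalgebra ℂ B}
    (hA : A = (Algebra.adjoin ℂ (Set.range s)).topologicalClosure)
    (hcomm : ∀ i j, s i * s j = s j * s i) {a b : B} (ha : a ∈ A) (hb : b ∈ A) :
    a * b = b * a := by
  subst hA
  have := Algebra.isMulCommutative_adjoin ℂ (s := Set.range s) (by
    rintro _ ⟨i, rfl⟩ _ ⟨j, rfl⟩; exact hcomm i j)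
  have h := ((Algebra.adjoin ℂ (Set.range s)).commRingTopologicalClosure
    (fun x y => mul_comm' x y)).mul_comm ⟨a, ha⟩ ⟨b, hb⟩
  exact congrArg Subtype.val h

/-- The maximal ideal space of the Banach algebra generated by a finite commuting family `s` is
homeomorphic, through evaluation at `s`, to any set of points `ζ` that contains all values of
characters and on which noncommutative polynomials are bounded by the norm of their value
at `s`. -/
theorem exists_homeomorph_characterSpace [CompleteSpace B] {ι : Type} [Finite ι] {s : ι → B}
    {A : Subalgebra ℂ B} (hA : A = (Algebra.adjoin ℂ (Set.range s)).topologicalClosure)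
    (hcomm : ∀ i j, s i * s j = s j * s i) {X : Set (ι → ℂ)}
    (hX : ∀ ψ : WeakDual.characterSpace ℂ A,
      (fun i => ψ ⟨s i, mem_of_eq_topologicalClosure hA i⟩) ∈ X)
    (hbound : ∀ ζ ∈ X, ∀ P : FreeAlgebra ℂ ι,
      ‖FreeAlgebra.lift ℂ ζ P‖ ≤ ‖FreeAlgebra.lift ℂ s P‖) :
    ∃ Ψ : WeakDual.characterSpace ℂ A ≃ₜ X,
      ∀ ψ i, (Ψ ψ : ι → ℂ) i = ψ ⟨s i, mem_of_eq_topologicalClosure hA i⟩ := by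
  have := completeSpace_of_eq_topologicalClosure hA
  let _ : NormedCommRing A :=
    { (inferInstance : NormedRing A) with
      mul_comm := fun a b => Subtype.ext (mul_comm_of_eq_topologicalClosure hA hcomm a.2 b.2) }
  set s' : ι → A := fun i => ⟨s i, mem_of_eq_topologicalClosure hA i⟩ with hs'
  have hdense := dense_adjoin_range hA
  let F : WeakDual.characterSpace ℂ A → X := fun ψ => ⟨fun i => ψ (s' i), hX ψ⟩
  have hF : Continuous F := by
    refine Continuous.subtype_mk (continuous_pi fun i => ?_) _
    exact (WeakDual.eval_continuous (s' i)).comp continuous_subtype_val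
  have hinj : Function.Injective F := by
    intro ψ φ h
    have hi : ∀ i, ψ (s' i) = φ (s' i) := fun i => congrFun (congrArg Subtype.val h) i
    apply WeakDual.CharacterSpace.ext
    have hcl : IsClosed {a : A | ψ a = φ a} :=
      isClosed_eq (map_continuous ψ) (map_continuous φ)
    have hsub : (Algebra.adjoin ℂ (Set.range s') : Set A) ⊆ {a : A | ψ a = φ a} := by
      intro a ha
      rw [SetLike.mem_coe, Algebra.adjoin_range_eq_range_freeAlgebra_lift] at ha
      obtain ⟨P, rfl⟩ := ha
      show ψ (FreeAlgebra.lift ℂ s' P) = φ (FreeAlgebra.lift ℂ s' P)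
      rw [apply_freeAlgebra_lift, apply_freeAlgebra_lift]
      simp_rw [hi]
    intro a
    exact hcl.closure_subset_iff.2 hsub (hdense a)
  have hsurj : Function.Surjective F := by
    rintro ⟨ζ, hζ⟩
    obtain ⟨ψ, hψ⟩ := exists_character_of_forall_norm_lift_le hdense (ζ := ζ) (fun P => by
      have h : ((FreeAlgebra.lift ℂ s' P : A) : B) = FreeAlgebra.lift ℂ s P :=
        apply_freeAlgebra_lift A.val s' P
      have h2 := hbound ζ hζ P
      rw [← h] at h2
      exact h2)
    exact ⟨ψ, Subtype.ext (funext hψ)⟩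
  let e : WeakDual.characterSpace ℂ A ≃ X := Equiv.ofBijective F ⟨hinj, hsurj⟩
  exact ⟨Continuous.homeoOfEquivCompactToT2 (f := e) hF, fun ψ i => rfl⟩

/-- A character of a closed subalgebra maps an element into the polynomially convex hull of its
spectrum in the whole algebra, by the spectral radius formula for polynomials in the element. -/
theorem character_apply_mem_polyHull [CompleteSpace B] [NormOneClass B] {A : Subalgebra ℂ B}
    [CompleteSpace A] (ψ : WeakDual.characterSpace ℂ A) (a : A) :
    ψ a ∈ polyHull (spectrum ℂ (a : B)) := by
  intro p C hC
  have : Nontrivial B := NormOneClass.nontrivial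
  set q : A := Polynomial.aeval a p with hq
  have hqB : (q : B) = Polynomial.aeval (a : B) p := by
    rw [hq]; exact (Polynomial.aeval_algHom_apply A.val a p).symm
  have hev : p.eval (ψ a) = ψ q := by
    rw [hq]
    have := Polynomial.aeval_algHom_apply (AlgHomClass.toAlgHom ψ : A →ₐ[ℂ] ℂ) a p
    simpa [Polynomial.coe_aeval_eq_eval] using this
  have hC0 : 0 ≤ C := by
    obtain ⟨w, hw⟩ := spectrum.nonempty (a : B)
    exact (norm_nonneg _).trans (hC w hw)
  have hrad : spectralRadius ℂ (q : B) ≤ ENNReal.ofReal C := by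
    rw [spectralRadius]
    refine iSup₂_le fun z hz => ?_
    rw [hqB, spectrum.map_polynomial_aeval] at hz
    obtain ⟨w, hw, rfl⟩ := hz
    rw [← enorm_eq_nnnorm, ← ofReal_norm]
    exact ENNReal.ofReal_le_ofReal (hC w hw)
  have hlim := spectrum.pow_nnnorm_pow_one_div_tendsto_nhds_spectralRadius (q : B)
  have : NormOneClass A := ⟨norm_one (α := B)⟩
  have hle : ∀ᶠ n : ℕ in atTop, ENNReal.ofReal ‖ψ q‖
      ≤ (‖(q : B) ^ n‖₊ : ℝ≥0∞) ^ (1 / n : ℝ) := by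
    filter_upwards [eventually_gt_atTop 0] with n hn
    have h1 : ‖ψ q‖ ^ n ≤ ‖(q : B) ^ n‖ := by
      rw [← norm_pow, ← map_pow]
      exact AlgHom.norm_apply_le_self ψ (q ^ n)
    rw [one_div, ENNReal.le_rpow_inv_iff (by exact_mod_cast hn), ENNReal.rpow_natCast,
      ← ENNReal.ofReal_pow (norm_nonneg _), ← enorm_eq_nnnorm, ← ofReal_norm]
    exact ENNReal.ofReal_le_ofReal h1
  have hfin := (ge_of_tendsto hlim hle).trans hrad
  rw [hev]
  exact (ENNReal.ofReal_le_ofReal_iff hC0).1 hfin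

end Characters

/-! ### Polynomially convex hulls -/

section Hull

/-- By the maximum principle, a polynomial bounded on the frontier of a compact set is bounded by
the same constant on its polynomially convex hull. -/
theorem norm_eval_le_of_mem_polyHull {K : Set ℂ} (hK : IsCompact K) {p : Polynomial ℂ} {C : ℝ}
    (hC : ∀ w ∈ frontier K, ‖p.eval w‖ ≤ C) {z : ℂ} (hz : z ∈ polyHull K) : ‖p.eval z‖ ≤ C := by
  refine hz p C fun w hw => ?_
  by_cases hwi : w ∈ interior K
  · refine Complex.norm_le_of_forall_mem_frontier_norm_le (U := interior K)
      (hK.isBounded.subset interior_subset) p.differentiable.diffContOnCl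
      (fun u hu => hC u (frontier_interior_subset hu)) (subset_closure hwi)
  · exact hC w ⟨subset_closure hw, hwi⟩

/-- A bound for noncommutative polynomials on the product of the frontiers of compact sets
persists on the product of their polynomially convex hulls: one variable is treated at a time. -/
theorem norm_lift_le_of_mem_polyHull {ι : Type} [Fintype ι] {K : ι → Set ℂ}
    (hK : ∀ i, IsCompact (K i)) {P : FreeAlgebra ℂ ι} {C : ℝ}
    (hC : ∀ ζ : ι → ℂ, (∀ i, ζ i ∈ frontier (K i)) → ‖FreeAlgebra.lift ℂ ζ P‖ ≤ C)
    {ζ : ι → ℂ} (hζ : ∀ i, ζ i ∈ polyHull (K i)) : ‖FreeAlgebra.lift ℂ ζ P‖ ≤ C := by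
  classical
  suffices H : ∀ (t : Finset ι) (ζ : ι → ℂ), (∀ i ∈ t, ζ i ∈ polyHull (K i)) →
      (∀ i ∉ t, ζ i ∈ frontier (K i)) → ‖FreeAlgebra.lift ℂ ζ P‖ ≤ C from
    H Finset.univ ζ (fun i _ => hζ i) (by simp)
  intro t
  induction t using Finset.induction_on with
  | empty => exact fun ζ _ h => hC ζ (by simpa using h)
  | insert j t hj ih =>
    intro ζ h1 h2
    let p : Polynomial ℂ :=
      FreeAlgebra.lift ℂ (Function.update (fun i => Polynomial.C (ζ i)) j Polynomial.X) P
    have hp : ∀ w, p.eval w = FreeAlgebra.lift ℂ (Function.update ζ j w) P := by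
      intro w
      have := apply_freeAlgebra_lift (Polynomial.aeval w : Polynomial ℂ →ₐ[ℂ] ℂ)
        (Function.update (fun i => Polynomial.C (ζ i)) j Polynomial.X) P
      rw [Polynomial.coe_aeval_eq_eval] at this
      rw [this]
      congr 2
      ext i
      by_cases hi : i = j
      · subst hi; simp
      · simp [hi]
    have := norm_eval_le_of_mem_polyHull (hK j) (p := p) (C := C) (fun w hw => ?_)
      (h1 j (Finset.mem_insert_self j t))
    · rwa [hp, Function.update_eq_self] at this
    · rw [hp]
      refine ih _ (fun i hi => ?_) (fun i hi => ?_)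
      · have hij : i ≠ j := fun h => hj (h ▸ hi)
        simpa [hij] using h1 i (Finset.mem_insert_of_mem hi)
      · by_cases hij : i = j
        · subst hij; simpa using hw
        · simpa [hij] using h2 i (by simp [hij, hi])

theorem norm_lift_le_of_mem_polyHull_spectrum {B : Type} [NormedRing B] [NormedAlgebra ℂ B]
    [CompleteSpace B] [NormOneClass B] (b : B) {ζ : Unit → ℂ}
    (hζ : ζ () ∈ polyHull (spectrum ℂ b)) (P : FreeAlgebra ℂ Unit) :
    ‖FreeAlgebra.lift ℂ ζ P‖ ≤ ‖FreeAlgebra.lift ℂ (fun _ => b) P‖ := by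
  let p : Polynomial ℂ := FreeAlgebra.lift ℂ (fun _ => Polynomial.X) P
  have h1 : Polynomial.aeval b p = FreeAlgebra.lift ℂ (fun _ : Unit => b) P := by
    simp [p, apply_freeAlgebra_lift]
  have h2 : p.eval (ζ ()) = FreeAlgebra.lift ℂ ζ P := by
    have := apply_freeAlgebra_lift (Polynomial.aeval (ζ ()) : Polynomial ℂ →ₐ[ℂ] ℂ)
      (fun _ : Unit => Polynomial.X) P
    rw [Polynomial.coe_aeval_eq_eval] at this
    simpa using this
  rw [← h1, ← h2]
  refine hζ p _ fun w hw => spectrum.norm_le_norm_of_mem (𝕜 := ℂ) ?_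
  exact spectrum.subset_polynomial_aeval b p ⟨w, hw, rfl⟩

/-- For a single generator the maximal ideal space is the polynomially convex hull of the
spectrum of the generator in the ambient algebra. -/
theorem exists_homeomorph_characterSpace_singleton {B : Type} [NormedRing B] [NormedAlgebra ℂ B]
    [CompleteSpace B] [NormOneClass B] (b : B) {A : Subalgebra ℂ B}
    (hA : A = (Algebra.adjoin ℂ {b}).topologicalClosure) (hb : b ∈ A) :
    ∃ Θ : WeakDual.characterSpace ℂ A ≃ₜ polyHull (spectrum ℂ b),
      ∀ ψ, (Θ ψ : ℂ) = ψ ⟨b, hb⟩ := by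
  have hA' : A = (Algebra.adjoin ℂ (Set.range fun _ : Unit => b)).topologicalClosure := by
    rw [Set.range_const, hA]
  have := completeSpace_of_eq_topologicalClosure hA
  obtain ⟨Ψ, hΨ⟩ := exists_homeomorph_characterSpace hA' (fun _ _ => rfl)
    (X := {ζ | ζ () ∈ polyHull (spectrum ℂ b)})
    (fun ψ => character_apply_mem_polyHull ψ ⟨b, hb⟩)
    (fun ζ hζ P => norm_lift_le_of_mem_polyHull_spectrum b hζ P)
  let e : {ζ : Unit → ℂ | ζ () ∈ polyHull (spectrum ℂ b)} ≃ₜ polyHull (spectrum ℂ b) :=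
    (Homeomorph.funUnique Unit ℂ).subtype (fun ζ => Iff.rfl)
  exact ⟨Ψ.trans e, fun ψ => hΨ ψ ()⟩

/-- A point of the frontier of the spectrum is an approximate eigenvalue: the translated element
is a limit of units whose inverses cannot stay bounded. -/
theorem exists_norm_lt_of_mem_frontier_spectrum {E : Type} [NormedAddCommGroup E]
    [NormedSpace ℂ E] [CompleteSpace E] {T : E →L[ℂ] E} {ζ : ℂ}
    (hζ : ζ ∈ frontier (spectrum ℂ T)) {ε : ℝ} (hε : 0 < ε) :
    ∃ v, ‖T v - ζ • v‖ < ε * ‖v‖ := by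
  by_contra! H
  have hζs : ζ ∈ spectrum ℂ T := (spectrum.isClosed T).frontier_subset hζ
  obtain ⟨η, hη, hd⟩ : ∃ η ∈ (spectrum ℂ T)ᶜ, dist ζ η < ε / 2 := by
    rw [← frontier_compl] at hζ
    exact Metric.mem_closure_iff.1 (frontier_subset_closure hζ) _ (by positivity)
  rw [Set.mem_compl_iff, spectrum.notMem_iff] at hη
  obtain ⟨u, hu⟩ := hη
  have happ : ∀ v, (u : E →L[ℂ] E) v = η • v - T v := fun v => by
    rw [hu]; simp [Algebra.algebraMap_eq_smul_one]
  rw [dist_eq_norm] at hd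
  have hlow : ∀ v, ε / 2 * ‖v‖ ≤ ‖(u : E →L[ℂ] E) v‖ := by
    intro v
    have h1 := H v
    have h2 : T v - ζ • v = -((u : E →L[ℂ] E) v) - (ζ - η) • v := by
      rw [happ, sub_smul]; abel
    have h3 : ‖T v - ζ • v‖ ≤ ‖(u : E →L[ℂ] E) v‖ + ‖ζ - η‖ * ‖v‖ := by
      rw [h2, ← norm_neg ((u : E →L[ℂ] E) v), ← norm_smul]
      exact norm_sub_le _ _
    nlinarith [norm_nonneg v]
  have hinv : ‖(↑u⁻¹ : E →L[ℂ] E)‖ ≤ 2 / ε := by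
    refine ContinuousLinearMap.opNorm_le_bound _ (by positivity) fun v => ?_
    have h1 := hlow ((↑u⁻¹ : E →L[ℂ] E) v)
    have h2 : (u : E →L[ℂ] E) ((↑u⁻¹ : E →L[ℂ] E) v) = v := by
      rw [← mul_apply_eq_comp, Units.mul_inv]; rfl
    rw [h2] at h1
    rw [div_mul_eq_mul_div, le_div_iff₀ hε]
    linarith
  rcases subsingleton_or_nontrivial E with hE | hE
  · have : Subsingleton (E →L[ℂ] E) := ⟨fun S T => by ext v; exact Subsingleton.elim _ _⟩
    rw [spectrum.of_subsingleton] at hζs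
    exact hζs
  refine hζs (u.ofNearby (algebraMap ℂ _ ζ - T) ?_).isUnit
  have hpos : 0 < ‖(↑u⁻¹ : E →L[ℂ] E)‖ := Units.norm_pos _
  have h1 : algebraMap ℂ (E →L[ℂ] E) ζ - T - u = algebraMap ℂ _ (ζ - η) := by
    rw [hu, map_sub]; abel
  rw [h1, norm_algebraMap']
  refine hd.trans_le ?_
  rw [le_inv_comm₀ (by positivity) hpos]
  simpa using hinv

end Hull

/-! ### Operators acting on one factor of a Hilbert tensor product -/

section TensorProduct

variable {ι : Type} [DecidableEq ι] {A : ι → Type} {H : Type} [NormedAddCommGroup H]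
  [InnerProductSpace ℂ H]

/-- The linear map sending the `a`-th coordinate vector of the `j`-th factor to
`b (update α j a)`: with `b α` read as a pure tensor, it inserts a finitely supported vector
as the `j`-th factor. -/
noncomputable def insertFactor (b : (∀ i, A i) → H) (j : ι) (α : ∀ i, A i) :
    (A j →₀ ℂ) →ₗ[ℂ] H :=
  Finsupp.linearCombination ℂ fun a => b (Function.update α j a)

/-- The squared `ℓ²` norm of a finitely supported vector. -/
noncomputable def normSqSum {κ : Type} (x : κ →₀ ℂ) : ℝ := x.sum fun _ c => ‖c‖ ^ 2

/-- The operator `S` is the ampliation of `T` from the `j`-th factor to the whole tensor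
product, of which `b` is the product basis. -/
def IsAmpliation (b : (∀ i, A i) → H) (j : ι) (T : (A j →₀ ℂ) →ₗ[ℂ] (A j →₀ ℂ))
    (S : H →L[ℂ] H) : Prop :=
  ∀ α, S (b α) = insertFactor b j α (T (Finsupp.single (α j) 1))

variable {b : (∀ i, A i) → H} {j : ι} {T : (A j →₀ ℂ) →ₗ[ℂ] (A j →₀ ℂ)} {S : H →L[ℂ] H}

theorem insertFactor_single (α : ∀ i, A i) (a : A j) :
    insertFactor b j α (Finsupp.single a 1) = b (Function.update α j a) := by
  simp [insertFactor]

theorem insertFactor_update (α : ∀ i, A i) (a : A j) :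
    insertFactor b j (Function.update α j a) = insertFactor b j α := by
  simp [insertFactor]

theorem IsAmpliation.apply_insertFactor (h : IsAmpliation b j T S) (α : ∀ i, A i)
    (x : A j →₀ ℂ) : S (insertFactor b j α x) = insertFactor b j α (T x) := by
  have : (S : H →ₗ[ℂ] H) ∘ₗ insertFactor b j α = insertFactor b j α ∘ₗ T := by
    refine Finsupp.lhom_ext' fun a => LinearMap.ext_ring ?_
    simp only [LinearMap.comp_apply, Finsupp.lsingle_apply, insertFactor_single,
      ContinuousLinearMap.coe_coe]
    rw [h, insertFactor_update, Function.update_self]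
  exact LinearMap.congr_fun this x

theorem norm_linearCombination_sq {κ : Type} {v : κ → H} (hv : Orthonormal ℂ v) (x : κ →₀ ℂ) :
    ‖Finsupp.linearCombination ℂ v x‖ ^ 2 = normSqSum x := by
  have h := hv.inner_finsupp_eq_sum_left x x
  rw [inner_self_eq_norm_sq_to_K] at h
  have h2 : ((‖Finsupp.linearCombination ℂ v x‖ ^ 2 : ℝ) : ℂ) = (normSqSum x : ℝ) := by
    push_cast
    rw [normSqSum, Finsupp.sum, Complex.ofReal_sum]
    refine h.trans (Finset.sum_congr rfl fun a _ => ?_)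
    show (starRingEnd ℂ) (x a) * x a = _
    rw [Complex.conj_mul']
    norm_cast
  exact_mod_cast h2

theorem norm_insertFactor_sq (hb : Orthonormal ℂ b) (α : ∀ i, A i) (x : A j →₀ ℂ) :
    ‖insertFactor b j α x‖ ^ 2 = normSqSum x :=
  norm_linearCombination_sq (hb.comp _ (Function.update_injective α j)) x

theorem IsAmpliation.commute {i : ι} (hij : i ≠ j) {T' : (A i →₀ ℂ) →ₗ[ℂ] (A i →₀ ℂ)}
    {S' : H →L[ℂ] H} (h : IsAmpliation b j T S) (h' : IsAmpliation b i T' S')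
    (hd : Dense (Submodule.span ℂ (Set.range b) : Set H)) : S' * S = S * S' := by
  apply ContinuousLinearMap.ext_on hd
  rintro _ ⟨α, rfl⟩
  have key : ∀ (x : A j →₀ ℂ) (y : A i →₀ ℂ),
      (x.sum fun a c => c • insertFactor b i (Function.update α j a) y)
        = y.sum fun a c => c • insertFactor b j (Function.update α i a) x := by
    intro x y
    simp only [insertFactor, Finsupp.linearCombination_apply, Finsupp.sum, Finset.smul_sum]
    rw [Finset.sum_comm]
    refine Finset.sum_congr rfl fun a _ => Finset.sum_congr rfl fun c _ => ?_
    rw [smul_comm, Function.update_comm hij]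
  have h1 : ∀ a, S' (b (Function.update α j a))
      = insertFactor b i (Function.update α j a) (T' (Finsupp.single (α i) 1)) := fun a => by
    rw [h', Function.update_of_ne hij]
  have h2 : ∀ a, S (b (Function.update α i a))
      = insertFactor b j (Function.update α i a) (T (Finsupp.single (α j) 1)) := fun a => by
    rw [h, Function.update_of_ne hij.symm]
  have e := key (T (Finsupp.single (α j) 1)) (T' (Finsupp.single (α i) 1))
  simp only [← h1, ← h2] at e
  show S' (S (b α)) = S (S' (b α))
  rw [h, h', insertFactor, insertFactor, Finsupp.linearCombination_apply,
    Finsupp.linearCombination_apply]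
  simp only [Finsupp.sum, map_sum, map_smul] at e ⊢
  exact e

/-- A lower bound for an operator on a factor is one for its ampliation: the space decomposes
orthogonally into copies of the factor, on each of which the ampliation acts as the operator. -/
theorem IsAmpliation.le_norm_sub_smul [Nonempty (A j)] (h : IsAmpliation b j T S)
    (hb : Orthonormal ℂ b) (hd : Dense (Submodule.span ℂ (Set.range b) : Set H)) {ζ : ℂ} {ε : ℝ}
    (hT : ∀ x, ε ^ 2 * normSqSum x ≤ normSqSum (T x - ζ • x)) (v : H) :
    ε * ‖v‖ ≤ ‖S v - ζ • v‖ := by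
  classical
  obtain ⟨a₀⟩ := ‹Nonempty (A j)›
  let L : ({γ : ∀ i, A i // γ j = a₀} →₀ (A j →₀ ℂ)) →ₗ[ℂ] H :=
    Finsupp.lsum ℂ fun γ => insertFactor b j γ
  have hL : ∀ f, L f = ∑ γ ∈ f.support, insertFactor b j γ (f γ) := fun f => by
    simp [L, Finsupp.sum]
  have horth : ∀ γ γ' : {γ : ∀ i, A i // γ j = a₀}, γ ≠ γ' → ∀ x y,
      inner ℂ (insertFactor b j γ x) (insertFactor b j γ' y) = 0 := by
    intro γ γ' hne x y
    rw [insertFactor, insertFactor, Finsupp.linearCombination_apply,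
      Finsupp.linearCombination_apply, Finsupp.sum, Finsupp.sum, sum_inner]
    refine Finset.sum_eq_zero fun a _ => ?_
    rw [inner_sum]
    refine Finset.sum_eq_zero fun c _ => ?_
    rw [inner_smul_left, inner_smul_right, hb.2, mul_zero, mul_zero]
    intro he
    apply hne
    ext i
    by_cases hi : i = j
    · subst hi; rw [γ.2, γ'.2]
    · simpa [hi] using congrFun he i
  have hnorm : ∀ (s : Finset {γ : ∀ i, A i // γ j = a₀}) (f : _ → (A j →₀ ℂ)),
      ‖∑ γ ∈ s, insertFactor b j γ (f γ)‖ ^ 2 = ∑ γ ∈ s, normSqSum (f γ) := by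
    intro s f
    induction s using Finset.induction_on with
    | empty => simp
    | insert γ s hγ ih =>
      rw [Finset.sum_insert hγ, Finset.sum_insert hγ, ← ih, ← norm_insertFactor_sq hb γ.1 (f γ)]
      simp only [sq]
      refine norm_add_sq_eq_norm_sq_add_norm_sq_of_inner_eq_zero (𝕜 := ℂ) _ _ ?_
      rw [inner_sum]
      exact Finset.sum_eq_zero fun γ' hγ' => 
        horth γ γ' (fun e => hγ (by rw [e]; exact hγ')) _ _
  have hrange : (Submodule.span ℂ (Set.range b) : Set H) ⊆ Set.range L := by
    rw [← LinearMap.coe_range]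
    refine Submodule.span_le.2 ?_
    rintro _ ⟨α, rfl⟩
    refine ⟨Finsupp.single ⟨Function.update α j a₀, by simp⟩ (Finsupp.single (α j) 1), ?_⟩
    simp [L, insertFactor_single]
  have hcl : IsClosed {v | ε * ‖v‖ ≤ ‖S v - ζ • v‖} := by
    apply isClosed_le <;> fun_prop
  refine hcl.closure_subset_iff.2 (hrange.trans ?_) (hd v)
  rintro _ ⟨f, rfl⟩
  refine abs_le_of_sq_le_sq' ?_ (norm_nonneg _) |>.2
  have h1 : S (L f) - ζ • L f
      = ∑ γ ∈ f.support, insertFactor b j γ (T (f γ) - ζ • f γ) := by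
    rw [hL, map_sum, Finset.smul_sum, ← Finset.sum_sub_distrib]
    refine Finset.sum_congr rfl fun γ _ => ?_
    rw [h.apply_insertFactor, map_sub, map_smul]
  rw [h1, mul_pow, hL, hnorm, hnorm, Finset.mul_sum]
  exact Finset.sum_le_sum fun γ _ => hT (f γ)

/-- Frontier points of the spectrum of an ampliation are approximate eigenvalues of the operator
on the factor. -/
theorem IsAmpliation.exists_approx_eigenvector [CompleteSpace H] [Nonempty (A j)]
    (h : IsAmpliation b j T S) (hb : Orthonormal ℂ b)
    (hd : Dense (Submodule.span ℂ (Set.range b) : Set H)) {ζ : ℂ}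
    (hζ : ζ ∈ frontier (spectrum ℂ S)) {ε : ℝ} (hε : 0 < ε) :
    ∃ x, normSqSum x = 1 ∧ normSqSum (T x - ζ • x) ≤ ε ^ 2 := by
  have hsmul : ∀ (r : ℂ) (x : A j →₀ ℂ), normSqSum (r • x) = ‖r‖ ^ 2 * normSqSum x := by
    intro r x
    obtain ⟨a₀⟩ := ‹Nonempty (A j)›
    rcases isEmpty_or_nonempty (∀ i, A i) with he | ⟨⟨α⟩⟩
    · exfalso
      have hs : (Submodule.span ℂ (Set.range b) : Set H) = {0} := by
        rw [Set.range_eq_empty, Submodule.span_empty]; rfl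
      obtain ⟨v, hv⟩ := exists_norm_lt_of_mem_frontier_spectrum hζ hε
      have hv0 : v = 0 := by
        have := hd v
        rw [hs, closure_singleton] at this
        exact this
      simp [hv0] at hv
    · rw [← norm_insertFactor_sq hb α, map_smul, norm_smul, mul_pow, norm_insertFactor_sq hb]
  by_contra! H
  obtain ⟨v, hv⟩ := exists_norm_lt_of_mem_frontier_spectrum hζ hε
  refine hv.not_ge (h.le_norm_sub_smul hb hd (fun x => ?_) v)
  have hx0 : 0 ≤ normSqSum x := Finset.sum_nonneg fun _ _ => by positivity
  rcases hx0.eq_or_lt with hx | hx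
  · rw [← hx, mul_zero]
    exact Finset.sum_nonneg fun _ _ => by positivity
  · set r : ℂ := (((√(normSqSum x))⁻¹ : ℝ) : ℂ) with hr
    have hr2 : ‖r‖ ^ 2 = (normSqSum x)⁻¹ := by
      rw [hr, Complex.norm_real, norm_inv, inv_pow, Real.norm_of_nonneg (Real.sqrt_nonneg _),
        Real.sq_sqrt hx0]
    have h1 := H (r • x) (by rw [hsmul, hr2, inv_mul_cancel₀ hx.ne'])
    rw [map_smul, smul_comm, ← smul_sub, hsmul, hr2, inv_mul_eq_div, lt_div_iff₀ hx] at h1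
    exact h1.le

variable [Fintype ι]

/-- The tensor product of finitely supported vectors, as a finitely supported function of the
multi-index. -/
noncomputable def tensorFinsupp : MultilinearMap ℂ (fun i => A i →₀ ℂ) ((∀ i, A i) →₀ ℂ) where
  toFun x := Finsupp.onFinset (Fintype.piFinset fun i => (x i).support)
    (fun α => ∏ i, x i (α i)) (fun α hα => by
      rw [Fintype.mem_piFinset]
      exact fun i => Finsupp.mem_support_iff.2 (Finset.prod_ne_zero_iff.1 hα i (Finset.mem_univ i)))
  map_update_add' x i y z := by
    ext α
    have := ((MultilinearMap.mkPiAlgebra ℂ ι ℂ).compLinearMap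
      (fun i => Finsupp.lapply (M := ℂ) (R := ℂ) (α i))).map_update_add x i y z
    exact this
  map_update_smul' x i c y := by
    ext α
    have := ((MultilinearMap.mkPiAlgebra ℂ ι ℂ).compLinearMap
      (fun i => Finsupp.lapply (M := ℂ) (R := ℂ) (α i))).map_update_smul x i c y
    exact this

theorem tensorFinsupp_apply (x : ∀ i, A i →₀ ℂ) (α : ∀ i, A i) :
    tensorFinsupp x α = ∏ i, x i (α i) := rfl

theorem normSqSum_tensorFinsupp (x : ∀ i, A i →₀ ℂ) :
    normSqSum (tensorFinsupp x) = ∏ i, normSqSum (x i) := by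
  have h0 : (tensorFinsupp x).support ⊆ Fintype.piFinset fun i => (x i).support := by
    intro α hα
    rw [Finsupp.mem_support_iff, tensorFinsupp_apply, Finset.prod_ne_zero_iff] at hα
    simpa using hα
  have h1 : normSqSum (tensorFinsupp x)
      = ∑ α ∈ Fintype.piFinset fun i => (x i).support, ‖∏ i, x i (α i)‖ ^ 2 :=
    Finsupp.sum_of_support_subset _ h0 _ (by simp)
  rw [h1]
  simp only [normSqSum, Finsupp.sum]
  rw [Finset.prod_univ_sum]
  refine Finset.sum_congr rfl fun α _ => ?_
  rw [norm_prod, Finset.prod_pow]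

/-- The tensor product of finitely supported vectors, expanded in the product basis `b`. -/
noncomputable def tensorVector (b : (∀ i, A i) → H) : MultilinearMap ℂ (fun i => A i →₀ ℂ) H :=
  (Finsupp.linearCombination ℂ b).compMultilinearMap tensorFinsupp

theorem norm_tensorVector_sq (hb : Orthonormal ℂ b) (x : ∀ i, A i →₀ ℂ) :
    ‖tensorVector b x‖ ^ 2 = ∏ i, normSqSum (x i) := by
  rw [← normSqSum_tensorFinsupp]
  exact norm_linearCombination_sq hb _

theorem tensorVector_single (α : ∀ i, A i) :
    tensorVector b (fun i => Finsupp.single (α i) 1) = b α := by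
  have : tensorFinsupp (fun i => Finsupp.single (α i) (1 : ℂ)) = Finsupp.single α 1 := by
    ext β
    rw [tensorFinsupp_apply]
    by_cases hβ : α = β
    · subst hβ; simp
    · obtain ⟨i, hi⟩ := Function.ne_iff.1 hβ
      rw [Finsupp.single_eq_of_ne' hβ]
      exact Finset.prod_eq_zero (Finset.mem_univ i) (by simp [hi])
  simp [tensorVector, this]

theorem tensorVector_update_single (α : ∀ i, A i) (y : A j →₀ ℂ) :
    tensorVector b (Function.update (fun i => Finsupp.single (α i) 1) j y)
      = insertFactor b j α y := by
  have : (tensorVector b).toLinearMap (fun i => Finsupp.single (α i) 1) j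
      = insertFactor b j α := by
    refine Finsupp.lhom_ext' fun a => LinearMap.ext_ring ?_
    simp only [LinearMap.comp_apply, Finsupp.lsingle_apply, insertFactor_single,
      MultilinearMap.toLinearMap_apply]
    rw [← tensorVector_single (b := b)]
    congr 1
    ext1 i
    by_cases hi : i = j
    · subst hi; simp
    · simp [hi]
  exact LinearMap.congr_fun this y

theorem IsAmpliation.apply_tensorVector (h : IsAmpliation b j T S) (x : ∀ i, A i →₀ ℂ) :
    S (tensorVector b x) = tensorVector b (Function.update x j (T (x j))) := by
  let f : ∀ i, (A i →₀ ℂ) →ₗ[ℂ] (A i →₀ ℂ) :=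
    Function.update (fun i => LinearMap.id) j T
  have hf : ∀ x : ∀ i, A i →₀ ℂ, (fun i => f i (x i)) = Function.update x j (T (x j)) := by
    intro x
    ext1 i
    by_cases hi : i = j
    · subst hi; simp [f]
    · simp [f, hi]
  have : (S : H →ₗ[ℂ] H).compMultilinearMap (tensorVector b)
      = (tensorVector b).compLinearMap f := by
    refine Module.Basis.ext_multilinear (fun i => Finsupp.basisSingleOne) fun α => ?_
    simp only [Finsupp.coe_basisSingleOne, LinearMap.compMultilinearMap_apply,
      MultilinearMap.compLinearMap_apply, ContinuousLinearMap.coe_coe]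
    rw [hf, tensorVector_single, tensorVector_update_single, h]
  have h2 := congrArg (fun g => g x) this
  simp only [LinearMap.compMultilinearMap_apply, MultilinearMap.compLinearMap_apply,
    ContinuousLinearMap.coe_coe, hf] at h2
  exact h2

/-- Noncommutative polynomials in ampliations dominate their values at points whose coordinates
lie in the frontiers of the spectra: tensor products of approximate eigenvectors are joint
approximate eigenvectors. -/
theorem norm_lift_le_of_mem_frontier_spectrum [CompleteSpace H] [∀ i, Nonempty (A i)]
    {T : ∀ i, (A i →₀ ℂ) →ₗ[ℂ] (A i →₀ ℂ)} {S : ι → H →L[ℂ] H}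
    (h : ∀ i, IsAmpliation b i (T i) (S i)) (hb : Orthonormal ℂ b)
    (hd : Dense (Submodule.span ℂ (Set.range b) : Set H)) {ζ : ι → ℂ}
    (hζ : ∀ i, ζ i ∈ frontier (spectrum ℂ (S i))) (P : FreeAlgebra ℂ ι) :
    ‖FreeAlgebra.lift ℂ ζ P‖ ≤ ‖FreeAlgebra.lift ℂ S P‖ := by
  choose x hx1 hx using fun (n : ℕ) i =>
    (h i).exists_approx_eigenvector hb hd (hζ i) (ε := 1 / ((n : ℝ) + 1)) (by positivity)
  let v : ℕ → H := fun n => tensorVector b (x n)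
  have hv1 : ∀ n, ‖v n‖ = 1 := fun n => by
    have := norm_tensorVector_sq hb (x n)
    simp only [hx1, Finset.prod_const_one] at this
    exact (pow_eq_one_iff_of_nonneg (norm_nonneg _) two_ne_zero).1 this
  have hgen : ∀ i, Tendsto (fun n => S i (v n) - ζ i • v n) atTop (𝓝 0) := by
    intro i
    refine squeeze_zero_norm (fun n => ?_) (tendsto_one_div_add_atTop_nhds_zero_nat (𝕜 := ℝ))
    have e : S i (v n) - ζ i • v n
        = tensorVector b (Function.update (x n) i (T i (x n i) - ζ i • x n i)) := by
      rw [(h i).apply_tensorVector, MultilinearMap.map_update_sub, MultilinearMap.map_update_smul,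
        Function.update_eq_self]
    refine abs_le_of_sq_le_sq' ?_ (by positivity) |>.2
    rw [e, norm_tensorVector_sq hb]
    refine le_trans (le_of_eq ?_) (hx n i)
    rw [← Finset.mul_prod_erase Finset.univ _ (Finset.mem_univ i), Function.update_self,
      Finset.prod_eq_one, mul_one]
    intro l hl
    rw [Function.update_of_ne (Finset.ne_of_mem_erase hl), hx1]
  have hlim : ∀ P : FreeAlgebra ℂ ι,
      Tendsto (fun n => FreeAlgebra.lift ℂ S P (v n) - FreeAlgebra.lift ℂ ζ P • v n)
        atTop (𝓝 0) := by
    intro P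
    induction P using FreeAlgebra.induction with
    | grade0 r =>
      simp [Algebra.algebraMap_eq_smul_one]
    | grade1 i => simpa using hgen i
    | mul P Q hP hQ =>
      have h1 := ((FreeAlgebra.lift ℂ S P).continuous.tendsto 0).comp hQ
      have h2 := hP.const_smul (FreeAlgebra.lift ℂ ζ Q)
      rw [map_zero] at h1
      rw [smul_zero] at h2
      have h3 := h1.add h2
      rw [add_zero] at h3
      refine h3.congr fun n => ?_
      simp only [Function.comp_apply, map_mul, map_sub, map_smul, mul_apply_eq_comp, smul_sub,
        smul_smul]
      rw [mul_comm (FreeAlgebra.lift ℂ ζ P)]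
      abel
    | add P Q hP hQ =>
      have := hP.add hQ
      rw [add_zero] at this
      refine this.congr fun n => ?_
      simp only [map_add, add_apply, add_smul]
      abel
  have h1 : Tendsto (fun n => ‖FreeAlgebra.lift ℂ S P‖
      + ‖FreeAlgebra.lift ℂ S P (v n) - FreeAlgebra.lift ℂ ζ P • v n‖) atTop
      (𝓝 (‖FreeAlgebra.lift ℂ S P‖ + 0)) := by
    have := (hlim P).norm
    rw [norm_zero] at this
    exact tendsto_const_nhds.add this
  rw [add_zero] at h1
  refine ge_of_tendsto' h1 fun n => ?_
  calc ‖FreeAlgebra.lift ℂ ζ P‖ = ‖FreeAlgebra.lift ℂ ζ P • v n‖ := by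
        rw [norm_smul, hv1, mul_one]
    _ = ‖FreeAlgebra.lift ℂ S P (v n)
          - (FreeAlgebra.lift ℂ S P (v n) - FreeAlgebra.lift ℂ ζ P • v n)‖ := by
        rw [sub_sub_cancel]
    _ ≤ _ := by
        refine (norm_sub_le _ _).trans ?_
        gcongr
        simpa [hv1] using (FreeAlgebra.lift ℂ S P).le_opNorm (v n)

end TensorProduct

/-! ### The weighted measure of the ball -/

section Measure

variable {ι : Type} [Fintype ι] {lam : ℝ}

theorem bergmanConst_pos (hlam : -1 < lam) : 0 < bergmanConst ι lam := by
  have h1 : 0 < Real.Gamma (Fintype.card ι + lam + 1) := Real.Gamma_pos_of_pos (by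
    have : (0 : ℝ) ≤ Fintype.card ι := Nat.cast_nonneg _
    linarith)
  have h2 : 0 < Real.Gamma (lam + 1) := Real.Gamma_pos_of_pos (by linarith)
  exact div_pos h1 (mul_pos (pow_pos Real.pi_pos _) h2)

/-- The density of the weighted measure of the ball as a function of `t = |z|²`, extended
by `0` outside the ball. -/
noncomputable def radialWeight (ι : Type) [Fintype ι] (lam t : ℝ) : ℝ :=
  if t < 1 then bergmanConst ι lam * (1 - t) ^ lam else 0

theorem radialWeight_nonneg (hlam : -1 < lam) (t : ℝ) : 0 ≤ radialWeight ι lam t := by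
  rw [radialWeight]
  split_ifs with h
  · exact mul_nonneg (bergmanConst_pos hlam).le (Real.rpow_nonneg (by linarith) _)
  · exact le_rfl

theorem measurable_radialWeight : Measurable (radialWeight ι lam) := by
  unfold radialWeight
  exact Measurable.ite measurableSet_Iio (by fun_prop) measurable_const

theorem bergmanMeasure_eq_withDensity : bergmanMeasure ι lam
    = volume.withDensity fun z : ι → ℂ => ENNReal.ofReal (radialWeight ι lam (∑ i, ‖z i‖ ^ 2)) := by
  rw [bergmanMeasure, ← withDensity_indicator isOpen_complexBall.measurableSet]
  congr 1
  ext z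
  by_cases hz : z ∈ complexBall ι
  · have : ∑ i, ‖z i‖ ^ 2 < 1 := hz
    simp [hz, radialWeight, this]
  · have : ¬ ∑ i, ‖z i‖ ^ 2 < 1 := hz
    simp [hz, radialWeight, this]

theorem integral_bergmanMeasure (hlam : -1 < lam) (F : (ι → ℂ) → ℂ) :
    ∫ z, F z ∂bergmanMeasure ι lam = ∫ z, radialWeight ι lam (∑ i, ‖z i‖ ^ 2) • F z := by
  have hm : Measurable fun z : ι → ℂ => radialWeight ι lam (∑ i, ‖z i‖ ^ 2) :=
    measurable_radialWeight.comp (by fun_prop)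
  rw [bergmanMeasure_eq_withDensity,
    integral_withDensity_eq_integral_toReal_smul hm.ennreal_ofReal (by simp)]
  simp_rw [ENNReal.toReal_ofReal (radialWeight_nonneg hlam _)]

theorem measurableEmbedding_rotate (θ : ι → Circle) :
    MeasurableEmbedding (fun (z : ι → ℂ) i => (θ i : ℂ) * z i) :=
  (Homeomorph.piCongrRight (fun i => (rotation (θ i)).toHomeomorph)).measurableEmbedding

/-- Rotating the coordinates independently preserves the weighted measure of the ball. -/
theorem measurePreserving_rotate (θ : ι → Circle) :
    MeasurePreserving (fun (z : ι → ℂ) i => (θ i : ℂ) * z i) (bergmanMeasure ι lam)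
      (bergmanMeasure ι lam) := by
  have hmp : MeasurePreserving (fun (u : ι → ℂ) i => (θ i : ℂ) * u i) volume volume :=
    volume_preserving_pi (fun i => (rotation (θ i)).measurePreserving)
  refine ⟨hmp.measurable, Measure.ext fun s hs => ?_⟩
  rw [Measure.map_apply hmp.measurable hs, bergmanMeasure_eq_withDensity,
    withDensity_apply _ (hmp.measurable hs), withDensity_apply _ hs]
  have h := hmp.setLIntegral_comp_preimage_emb (measurableEmbedding_rotate θ)
    (fun z => ENNReal.ofReal (radialWeight ι lam (∑ i, ‖z i‖ ^ 2))) s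
  simp only [norm_mul, Circle.norm_coe, one_mul] at h
  exact h

theorem integral_rotate (θ : ι → Circle) (F : (ι → ℂ) → ℂ) :
    ∫ z, F (fun i => θ i * z i) ∂bergmanMeasure ι lam = ∫ z, F z ∂bergmanMeasure ι lam :=
  (measurePreserving_rotate θ).integral_comp (measurableEmbedding_rotate θ) F

end Measure

/-! ### Polar coordinates in a group of variables -/

section Polar

/-- Lebesgue measure on `ℂ^κ` with the Euclidean norm. -/
noncomputable def euclideanVolume (κ : Type) [Fintype κ] : Measure (EuclideanSpace ℂ κ) :=
  Measure.map (MeasurableEquiv.toLp 2 (κ → ℂ)) volume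

variable {κ : Type} [Fintype κ]

instance : (euclideanVolume κ).IsAddHaarMeasure :=
  (PiLp.continuousLinearEquiv 2 ℝ (fun _ : κ => ℂ)).symm.isAddHaarMeasure_map volume

theorem measurePreserving_toLp :
    MeasurePreserving (MeasurableEquiv.toLp 2 (κ → ℂ)) volume (euclideanVolume κ) :=
  ⟨(MeasurableEquiv.toLp 2 (κ → ℂ)).measurable, rfl⟩

/-- Polar coordinates `(ω, r) ↦ r ω` on `ℂ^κ`, with respect to the Euclidean norm. -/
noncomputable def polarMap (κ : Type) [Fintype κ]
    (q : Metric.sphere (0 : EuclideanSpace ℂ κ) 1 × Set.Ioi (0 : ℝ)) : κ → ℂ :=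
  fun i => (q.2 : ℝ) • (q.1 : EuclideanSpace ℂ κ) i

/-- The radial factor of Lebesgue measure on `ℂ^κ` in polar coordinates. -/
noncomputable def radialMeasure (κ : Type) [Fintype κ] : Measure (Set.Ioi (0 : ℝ)) :=
  Measure.volumeIoiPow (Module.finrank ℝ (EuclideanSpace ℂ κ) - 1)

instance : SigmaFinite (radialMeasure κ) :=
  inferInstanceAs (SigmaFinite (Measure.volumeIoiPow _))

theorem polarMap_eq : polarMap κ = (MeasurableEquiv.toLp 2 (κ → ℂ)).symm ∘ Subtype.val ∘
    (homeomorphUnitSphereProd (EuclideanSpace ℂ κ)).symm := by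
  ext q i
  rfl

theorem measurePreserving_polarMap [Nonempty κ] : MeasurePreserving (polarMap κ)
    ((euclideanVolume κ).toSphere.prod (radialMeasure κ)) volume := by
  have h1 := MeasurePreserving.symm
    (homeomorphUnitSphereProd (EuclideanSpace ℂ κ)).toMeasurableEquiv
    (euclideanVolume κ).measurePreserving_homeomorphUnitSphereProd
  have h2 : MeasurePreserving (Subtype.val : ({0}ᶜ : Set (EuclideanSpace ℂ κ)) → _)
      ((euclideanVolume κ).comap Subtype.val) (euclideanVolume κ) := by
    have := measurePreserving_subtype_coe (μa := euclideanVolume κ)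
      (measurableSet_singleton (0 : EuclideanSpace ℂ κ)).compl
    rwa [restrict_compl_singleton] at this
  rw [polarMap_eq]
  exact (measurePreserving_toLp.symm _).comp (h2.comp h1)

theorem measurableEmbedding_polarMap : MeasurableEmbedding (polarMap κ) := by
  rw [polarMap_eq]
  exact (MeasurableEquiv.measurableEmbedding _).comp
    ((MeasurableEmbedding.subtype_coe (measurableSet_singleton _).compl).comp
      (Homeomorph.measurableEmbedding _))

theorem sum_norm_polarMap_sq (q : Metric.sphere (0 : EuclideanSpace ℂ κ) 1 × Set.Ioi (0 : ℝ)) :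
    ∑ i, ‖polarMap κ q i‖ ^ 2 = (q.2 : ℝ) ^ 2 := by
  have h : ‖(q.1 : EuclideanSpace ℂ κ)‖ = 1 := by simp
  rw [EuclideanSpace.norm_eq, Real.sqrt_eq_one] at h
  simp only [polarMap, norm_smul, mul_pow, ← Finset.mul_sum, h, mul_one]
  simp

/-- The integral of a function over the Euclidean unit sphere of `ℂ^κ`. -/
noncomputable def sphereIntegral (h : (κ → ℂ) → ℂ) : ℂ :=
  ∫ ω : Metric.sphere (0 : EuclideanSpace ℂ κ) 1, h (fun i => (ω : EuclideanSpace ℂ κ) i)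
    ∂(euclideanVolume κ).toSphere

/-- The integral left over once the sphere of the `κ`-variables has been integrated out, for a
function homogeneous of degree `s` in these and equal to `w` in the others. -/
noncomputable def radialIntegral (κ : Type) [Fintype κ] {κ' : Type} [Fintype κ'] (R : ℝ → ℝ)
    (s : ℕ) (w : (κ' → ℂ) → ℂ) : ℂ :=
  ∫ q : Set.Ioi (0 : ℝ) × (κ' → ℂ), R ((q.1 : ℝ) ^ 2 + ∑ i, ‖q.2 i‖ ^ 2) •
    (((q.1 : ℝ) : ℂ) ^ s * w q.2) ∂(radialMeasure κ).prod volume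

/-- Integration in polar coordinates in a group of variables: the integral of a radial weight
times a function `h` homogeneous of degree `s` in that group and a function `w` of the other
variables splits off the integral of `h` over the sphere. -/
theorem integral_mul_of_homogeneous {ι : Type} [Fintype ι] (p : ι → Prop) [DecidablePred p]
    [Nonempty {i // p i}] (R : ℝ → ℝ) {s : ℕ} {h : ({i // p i} → ℂ) → ℂ}
    (hh : ∀ r : ℝ, 0 < r → ∀ x, h (fun i => r • x i) = (r : ℂ) ^ s * h x)
    (w : ({i // ¬ p i} → ℂ) → ℂ) :
    ∫ z : ι → ℂ, R (∑ i, ‖z i‖ ^ 2) • (h (fun i => z i) * w (fun i => z i))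
      = sphereIntegral h * radialIntegral {i // p i} R s w := by
  have h1 := (volume_preserving_piEquivPiSubtypeProd (fun _ : ι => ℂ) p).integral_comp'
    (fun q : ({i // p i} → ℂ) × ({i // ¬ p i} → ℂ) =>
      R (∑ i, ‖q.1 i‖ ^ 2 + ∑ i, ‖q.2 i‖ ^ 2) • (h q.1 * w q.2))
  have h2 : ∫ z : ι → ℂ, R (∑ i, ‖z i‖ ^ 2) • (h (fun i => z i) * w (fun i => z i))
      = ∫ q : ({i // p i} → ℂ) × ({i // ¬ p i} → ℂ),
        R (∑ i, ‖q.1 i‖ ^ 2 + ∑ i, ‖q.2 i‖ ^ 2) • (h q.1 * w q.2) := by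
    rw [← h1]
    congr 1
    ext z
    rw [← Fintype.sum_subtype_add_sum_subtype p]
    rfl
  have : IsFiniteMeasure (euclideanVolume {i // p i}).toSphere := inferInstance
  have hid : MeasurableEmbedding (id : ({i // ¬ p i} → ℂ) → _) := MeasurableEmbedding.id
  have hmp := (measurePreserving_polarMap (κ := {i // p i})).prod
    (MeasurePreserving.id (volume : Measure ({i // ¬ p i} → ℂ)))
  have hme := (measurableEmbedding_polarMap (κ := {i // p i})).prodMap hid
  have hassoc := measurePreserving_prodAssoc (euclideanVolume {i // p i}).toSphere
    (radialMeasure {i // p i}) (volume : Measure ({i // ¬ p i} → ℂ))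
  rw [h2, Measure.volume_eq_prod, ← hmp.integral_comp hme, sphereIntegral, radialIntegral,
    ← integral_prod_mul, ← hassoc.integral_comp']
  congr 1
  ext q
  have h3 : h (polarMap _ q.1)
      = ((q.1.2 : ℝ) : ℂ) ^ s * h (fun i => (q.1.1 : EuclideanSpace ℂ _) i) :=
    hh _ q.1.2.2 _
  simp only [Prod.map, id, sum_norm_polarMap_sq, h3, MeasurableEquiv.prodAssoc,
    MeasurableEquiv.coe_mk, Equiv.prodAssoc_apply, Complex.real_smul]
  ring

end Polar

section Finite

variable {ι : Type} [Fintype ι] {lam : ℝ}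

theorem integrableOn_radialWeight_sq (hlam : -1 < lam) (d : ℕ) :
    IntegrableOn (fun r : ℝ => r ^ d • radialWeight ι lam (r ^ 2)) (Set.Ioi 0) := by
  have h0 : IntervalIntegrable (fun r : ℝ => (1 - r) ^ lam) volume 0 1 := by
    have := ((intervalIntegral.intervalIntegrable_rpow' (a := 0) (b := 1)
      hlam).comp_sub_left 1).symm
    simpa using this
  have h1 : IntegrableOn (fun r : ℝ => bergmanConst ι lam * (1 + (1 - r) ^ lam)) (Set.Ioo 0 1) := by
    have := (intervalIntegrable_iff_integrableOn_Ioo_of_le zero_le_one).1 h0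
    exact ((integrable_const (1 : ℝ)).add this).const_mul _
  have h2 : IntegrableOn (fun r : ℝ => r ^ d • radialWeight ι lam (r ^ 2)) (Set.Ioo 0 1) := by
    refine Integrable.mono' h1 ?_ ?_
    · have hm : Measurable fun r : ℝ => radialWeight ι lam (r ^ 2) :=
        measurable_radialWeight.comp (by fun_prop)
      exact ((measurable_id.pow_const d).smul hm).aestronglyMeasurable
    · filter_upwards [ae_restrict_mem measurableSet_Ioo] with r hr
      have hr2 : r ^ 2 < 1 := by nlinarith [hr.1, hr.2]
      have hc := bergmanConst_pos (ι := ι) hlam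
      rw [norm_smul, norm_pow, Real.norm_of_nonneg hr.1.le,
        Real.norm_of_nonneg (radialWeight_nonneg hlam _), radialWeight, if_pos hr2]
      have hpow : r ^ d ≤ 1 := pow_le_one₀ hr.1.le hr.2.le
      have hA : (1 - r ^ 2) ^ lam ≤ 1 + (1 - r) ^ lam := by
        have h3 : 0 ≤ (1 - r) ^ lam := Real.rpow_nonneg (by linarith [hr.2]) _
        rcases le_or_gt 0 lam with hl | hl
        · have := Real.rpow_le_one (x := 1 - r ^ 2) (by linarith) (by nlinarith) hl
          linarith
        · have := Real.rpow_le_rpow_of_nonpos (x := 1 - r) (y := 1 - r ^ 2) (by linarith [hr.2])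
            (by nlinarith [hr.1, hr.2]) hl.le
          linarith
      have h4 : 0 ≤ (1 - r ^ 2) ^ lam := Real.rpow_nonneg (by linarith) _
      calc r ^ d * (bergmanConst ι lam * (1 - r ^ 2) ^ lam)
          ≤ 1 * (bergmanConst ι lam * (1 + (1 - r) ^ lam)) := by gcongr
        _ = _ := one_mul _
  have h5 : IntegrableOn (fun r : ℝ => r ^ d • radialWeight ι lam (r ^ 2)) (Set.Ici 1) := by
    refine IntegrableOn.congr_fun integrableOn_zero (fun r hr => ?_) measurableSet_Ici
    have : ¬ r ^ 2 < 1 := by have : (1 : ℝ) ≤ r := hr; nlinarith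
    simp [radialWeight, this]
  rw [← Set.Ioo_union_Ici_eq_Ioi zero_lt_one]
  exact h2.union h5

theorem isFiniteMeasure_bergmanMeasure (hlam : -1 < lam) :
    IsFiniteMeasure (bergmanMeasure ι lam) := by
  rw [bergmanMeasure_eq_withDensity]
  refine isFiniteMeasure_withDensity_ofReal (Integrable.hasFiniteIntegral ?_)
  rcases isEmpty_or_nonempty ι with hι | hι
  · simp
  · have h : Integrable (fun x : EuclideanSpace ℂ ι => radialWeight ι lam (‖x‖ ^ 2))
        (euclideanVolume ι) := by
      rw [integrable_fun_norm_addHaar (euclideanVolume ι)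
        (f := fun r => radialWeight ι lam (r ^ 2))]
      exact integrableOn_radialWeight_sq hlam _
    have h2 := (measurePreserving_toLp (κ := ι)).integrable_comp_of_integrable h
    refine h2.congr (.of_forall fun z => ?_)
    simp [EuclideanSpace.norm_sq_eq]

end Finite

/-! ### Homogeneous parts of holomorphic functions of several variables -/

section Holomorphic

theorem integral_circleMap_inv_pow_mul {φ : ℂ → ℂ} {ρ : ℝ} (hρ : 0 < ρ)
    (hφ : DifferentiableOn ℂ φ (Metric.closedBall 0 ρ)) (n : ℕ) :
    ∫ θ in Set.Ioc 0 (2 * Real.pi), (circleMap 0 ρ θ ^ n)⁻¹ * φ (circleMap 0 ρ θ)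
      = (2 * Real.pi / n.factorial) * iteratedDeriv n φ 0 := by
  have h := hφ.circleIntegral_one_div_sub_center_pow_smul hρ n
  rw [circleIntegral, intervalIntegral.integral_of_le (by positivity)] at h
  have h2 : ∀ θ, deriv (circleMap 0 ρ) θ • (1 / (circleMap 0 ρ θ - 0) ^ (n + 1)) •
      φ (circleMap 0 ρ θ) = Complex.I * ((circleMap 0 ρ θ ^ n)⁻¹ * φ (circleMap 0 ρ θ)) := by
    intro θ
    have h0 : circleMap 0 ρ θ ≠ 0 := circleMap_ne_center hρ.ne'
    rw [deriv_circleMap]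
    simp only [smul_eq_mul, sub_zero]
    field_simp
    ring
  simp_rw [h2] at h
  rw [integral_const_mul] at h
  apply mul_left_cancel₀ Complex.I_ne_zero
  rw [h, smul_eq_mul]
  ring

variable {ι : Type} [Fintype ι] {U : Set (ι → ℂ)} {g : (ι → ℂ) → ℂ}

/-- Directional derivatives of a holomorphic function of several variables are holomorphic: they
are circle averages of translates of the function, which may be differentiated under the
integral sign. -/
theorem differentiableOn_fderiv_apply (hU : IsOpen U) (hg : DifferentiableOn ℂ g U) (v : ι → ℂ) :
    DifferentiableOn ℂ (fun z => fderiv ℂ g z v) U := by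
  intro z₀ hz₀
  apply DifferentiableAt.differentiableWithinAt
  obtain ⟨R', hR', hRU'⟩ := Metric.nhds_basis_closedBall.mem_iff.1 (hU.mem_nhds hz₀)
  set R := R' / 3 with hR3
  have hR : 0 < R := by positivity
  have hRU : Metric.closedBall z₀ (3 * R) ⊆ U := by
    rw [hR3]; convert hRU' using 2; ring
  set ρ := R / (‖v‖ + 1) with hρdef
  have hρ : 0 < ρ := by positivity
  have hρv : ρ * ‖v‖ ≤ R := by
    rw [hρdef, div_mul_eq_mul_div, div_le_iff₀ (by positivity)]
    nlinarith [norm_nonneg v]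
  have hmem : ∀ z ∈ Metric.ball z₀ R, ∀ t : ℂ, ‖t‖ ≤ ρ →
      z + t • v ∈ Metric.closedBall z₀ (2 * R) := by
    intro z hz t ht
    rw [mem_closedBall_iff_norm]
    have h1 : ‖z - z₀‖ < R := by rwa [mem_ball_iff_norm] at hz
    have h2 : ‖t • v‖ ≤ R := by
      rw [norm_smul]
      exact (mul_le_mul_of_nonneg_right ht (norm_nonneg _)).trans hρv
    calc ‖z + t • v - z₀‖ = ‖(z - z₀) + t • v‖ := by rw [add_sub_right_comm]
      _ ≤ ‖z - z₀‖ + ‖t • v‖ := norm_add_le _ _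
      _ ≤ 2 * R := by linarith
  have hsub : Metric.closedBall z₀ (2 * R) ⊆ U :=
    (Metric.closedBall_subset_closedBall (by linarith)).trans hRU
  have hdiff : ∀ w ∈ Metric.closedBall z₀ (2 * R), DifferentiableAt ℂ g w := fun w hw =>
    hg.differentiableAt (hU.mem_nhds (hsub hw))
  obtain ⟨M, hM⟩ := (isCompact_closedBall z₀ (3 * R)).exists_bound_of_continuousOn
    (hg.continuousOn.mono hRU)
  have hbound : ∀ w ∈ Metric.closedBall z₀ (2 * R), ‖fderiv ℂ g w‖ ≤ 2 * M / R := by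
    intro w hw
    have hs : Metric.ball w R ⊆ Metric.closedBall z₀ (3 * R) := by
      refine Metric.ball_subset_closedBall.trans (Metric.closedBall_subset_closedBall' ?_)
      have := Metric.mem_closedBall.1 hw
      linarith
    refine Complex.norm_fderiv_le_div_of_mapsTo_ball (hg.mono (hs.trans hRU)) ?_ hR
    intro x hx
    rw [mem_closedBall_iff_norm]
    have h1 := hM x (hs hx)
    have h2 := hM w (hs (Metric.mem_ball_self hR))
    linarith [norm_sub_le (g x) (g w)]
  have hcirc : ∀ θ, ‖circleMap 0 ρ θ‖ = ρ := fun θ => by simp [abs_of_pos hρ]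
  have hformula : ∀ z ∈ Metric.ball z₀ R, fderiv ℂ g z v = (2 * Real.pi : ℂ)⁻¹ *
      ∫ θ in Set.Ioc 0 (2 * Real.pi), (circleMap 0 ρ θ)⁻¹ * g (z + circleMap 0 ρ θ • v) := by
    intro z hz
    have hφ : DifferentiableOn ℂ (fun t : ℂ => g (z + t • v)) (Metric.closedBall 0 ρ) := by
      intro t ht
      have h1 := hdiff _ (hmem z hz t (by simpa using ht))
      exact (h1.comp t (by fun_prop : DifferentiableAt ℂ (fun s : ℂ => z + s • v)
        t)).differentiableWithinAt
    have h := integral_circleMap_inv_pow_mul hρ hφ 1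
    have hd : iteratedDeriv 1 (fun t : ℂ => g (z + t • v)) 0 = fderiv ℂ g z v := by
      rw [iteratedDeriv_one]
      have h1 : DifferentiableAt ℂ g (z + (0 : ℂ) • v) :=
        hdiff _ (hmem z hz 0 (by simpa using hρ.le))
      have h2 : HasDerivAt (fun t : ℂ => z + t • v) v 0 := by
        simpa using ((hasDerivAt_id (0 : ℂ)).smul_const v).const_add z
      have h3 := (h1.hasFDerivAt.comp_hasDerivAt 0 h2).deriv
      simpa [Function.comp_def] using h3
    simp only [pow_one] at h
    rw [h, hd]
    have : (Real.pi : ℂ) ≠ 0 := by exact_mod_cast Real.pi_ne_zero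
    simp
    field_simp
  have hcont : ∀ z ∈ Metric.ball z₀ R,
      Continuous fun θ => (circleMap 0 ρ θ)⁻¹ * g (z + circleMap 0 ρ θ • v) := by
    intro z hz
    have h1 : Continuous fun θ => (circleMap 0 ρ θ)⁻¹ :=
      (continuous_circleMap 0 ρ).inv₀ fun θ => circleMap_ne_center hρ.ne'
    refine h1.mul ?_
    rw [continuous_iff_continuousAt]
    intro θ
    have h2 := (hdiff _ (hmem z hz _ (hcirc θ).le)).continuousAt
    refine ContinuousAt.comp (f := fun θ => z + circleMap 0 ρ θ • v) h2 ?_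
    have := continuous_circleMap 0 ρ
    fun_prop
  have hderiv := hasFDerivAt_integral_of_dominated_of_fderiv_le (𝕜 := ℂ)
    (μ := volume.restrict (Set.Ioc 0 (2 * Real.pi))) (x₀ := z₀) (s := Metric.ball z₀ R)
    (F := fun z θ => (circleMap 0 ρ θ)⁻¹ * g (z + circleMap 0 ρ θ • v))
    (F' := fun z θ => (circleMap 0 ρ θ)⁻¹ • fderiv ℂ g (z + circleMap 0 ρ θ • v))
    (bound := fun _ => ρ⁻¹ * (2 * M / R)) (Metric.ball_mem_nhds _ hR)
    (by
      filter_upwards [Metric.ball_mem_nhds z₀ hR] with z hz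
      exact (hcont z hz).aestronglyMeasurable)
    ((hcont z₀ (Metric.mem_ball_self hR)).integrableOn_Ioc)
    (by
      have h1 : Measurable fun θ => (circleMap 0 ρ θ)⁻¹ := (continuous_circleMap 0 ρ).measurable.inv
      have h2 : Measurable fun θ => fderiv ℂ g (z₀ + circleMap 0 ρ θ • v) := by
        refine (measurable_fderiv ℂ g).comp ?_
        have := continuous_circleMap 0 ρ
        exact Continuous.measurable (by fun_prop)
      exact (h1.smul h2).aestronglyMeasurable)
    (by
      refine .of_forall fun θ z hz => ?_
      rw [norm_smul, norm_inv, hcirc]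
      gcongr
      exact hbound _ (hmem z hz _ (hcirc θ).le))
    (integrable_const _)
    (by
      refine .of_forall fun θ z hz => ?_
      have h1 := (hdiff _ (hmem z hz _ (hcirc θ).le)).hasFDerivAt
      have h2 : HasFDerivAt (fun z => g (z + circleMap 0 ρ θ • v))
          (fderiv ℂ g (z + circleMap 0 ρ θ • v)) z := by
        simpa [Function.comp_def] using
          h1.comp z ((hasFDerivAt_id z).add_const (circleMap 0 ρ θ • v))
      exact h2.const_mul _)
  refine ((hderiv.differentiableAt.const_mul (2 * Real.pi : ℂ)⁻¹).congr_of_eventuallyEq ?_)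
  filter_upwards [Metric.ball_mem_nhds z₀ hR] with z hz
  exact hformula z hz

theorem eventually_smul_mem {κ : Type} {U : Set (κ → ℂ)} (hU : IsOpen U) (h0 : (0 : κ → ℂ) ∈ U)
    (z : κ → ℂ) :
    ∀ᶠ t : ℂ in 𝓝 0, t • z ∈ U := by
  have : Tendsto (fun t : ℂ => t • z) (𝓝 0) (𝓝 ((0 : ℂ) • z)) :=
    (by fun_prop : Continuous fun t : ℂ => t • z).tendsto 0
  rw [zero_smul] at this
  exact this (hU.mem_nhds h0)

theorem contDiffAt_comp_smul (hU : IsOpen U) (h0 : (0 : ι → ℂ) ∈ U) (hg : DifferentiableOn ℂ g U)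
    (z : ι → ℂ) (n : ℕ) : ContDiffAt ℂ n (fun t : ℂ => g (t • z)) 0 := by
  have hev := eventually_smul_mem hU h0 z
  obtain ⟨s, hs, hso, h0s⟩ := eventually_nhds_iff.1 hev
  have hd : DifferentiableOn ℂ (fun t : ℂ => g (t • z)) s := fun t ht =>
    ((hg.differentiableAt (hU.mem_nhds (hs t ht))).comp t
      (by fun_prop : DifferentiableAt ℂ (fun s : ℂ => s • z) t)).differentiableWithinAt
  exact (hd.analyticAt (hso.mem_nhds h0s)).contDiffAt

/-- The Taylor coefficients at `0` of the restrictions of a holomorphic function to the complex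
lines through the origin are homogeneous polynomials in the direction of the line. -/
theorem exists_mvPolynomial_iteratedDeriv (hU : IsOpen U) (h0 : (0 : ι → ℂ) ∈ U) (d : ℕ)
    (hg : DifferentiableOn ℂ g U) :
    ∃ p : MvPolynomial ι ℂ, (∀ z, iteratedDeriv d (fun t : ℂ => g (t • z)) 0
      = MvPolynomial.eval z p) ∧
        ∀ (c : ℂ) z, MvPolynomial.eval (c • z) p = c ^ d * MvPolynomial.eval z p := by
  classical
  induction d generalizing g with
  | zero => exact ⟨MvPolynomial.C (g 0), fun z => by simp, fun c z => by simp⟩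
  | succ d ih =>
    choose p hp hph using fun i => ih (differentiableOn_fderiv_apply hU hg (Pi.single i (1 : ℂ)))
    refine ⟨∑ i, MvPolynomial.X i * p i, fun z => ?_, fun c z => ?_⟩
    swap
    · simp only [map_sum, map_mul, MvPolynomial.eval_X, hph, Pi.smul_apply, smul_eq_mul,
        Finset.mul_sum]
      exact Finset.sum_congr rfl fun i _ => by ring
    have hev : deriv (fun t : ℂ => g (t • z)) =ᶠ[𝓝 0]
        fun t => ∑ i, z i * fderiv ℂ g (t • z) (Pi.single i 1) := by
      filter_upwards [eventually_smul_mem hU h0 z] with t ht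
      have h1 : DifferentiableAt ℂ g (t • z) := hg.differentiableAt (hU.mem_nhds ht)
      have h2 : HasDerivAt (fun t : ℂ => t • z) z t := by
        simpa using (hasDerivAt_id t).smul_const z
      have h3 := (h1.hasFDerivAt.comp_hasDerivAt t h2).deriv
      rw [Function.comp_def] at h3
      rw [h3, ← congrArg (fderiv ℂ g (t • z)) (Finset.univ_sum_single z), map_sum]
      refine Finset.sum_congr rfl fun i _ => ?_
      rw [← smul_eq_mul, ← map_smul, ← Pi.single_smul, smul_eq_mul, mul_one]
    rw [iteratedDeriv_succ', hev.iteratedDeriv_eq, iteratedDeriv_fun_sum]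
    · simp only [map_sum, map_mul, MvPolynomial.eval_X, ← hp]
      exact Finset.sum_congr rfl fun i _ => iteratedDeriv_const_mul_field _ _
    · intro i _
      exact contDiffAt_const.mul (contDiffAt_comp_smul hU h0
        (differentiableOn_fderiv_apply hU hg _) z d)

end Holomorphic

/-! ### Completeness of the monomials -/

section Monomials

variable {ι : Type} [Fintype ι] {lam : ℝ}

/-- The monomial `z ↦ z ^ α`. -/
def monomial (α : ι → ℕ) (z : ι → ℂ) : ℂ := ∏ i, z i ^ α i

theorem differentiable_monomial (α : ι → ℕ) : Differentiable ℂ (monomial α) := by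
  unfold monomial
  fun_prop

theorem ae_mem_complexBall : ∀ᵐ z ∂bergmanMeasure ι lam, z ∈ complexBall ι :=
  (withDensity_absolutelyContinuous _ _).ae_le
    (ae_restrict_mem isOpen_complexBall.measurableSet)

theorem norm_apply_le_one {z : ι → ℂ} (hz : z ∈ complexBall ι) (i : ι) : ‖z i‖ ≤ 1 := by
  have h1 : ∑ i, ‖z i‖ ^ 2 < 1 := hz
  have h2 : ‖z i‖ ^ 2 ≤ ∑ i, ‖z i‖ ^ 2 :=
    Finset.single_le_sum (f := fun i => ‖z i‖ ^ 2) (fun _ _ => by positivity) (Finset.mem_univ i)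
  nlinarith [norm_nonneg (z i)]

theorem smul_mem_complexBall {z : ι → ℂ} (hz : z ∈ complexBall ι) {c : ℂ} (hc : ‖c‖ ≤ 1) :
    c • z ∈ complexBall ι := by
  have h1 : ∑ i, ‖z i‖ ^ 2 < 1 := hz
  show ∑ i, ‖(c • z) i‖ ^ 2 < 1
  refine lt_of_le_of_lt (Finset.sum_le_sum fun i _ => ?_) h1
  rw [Pi.smul_apply, norm_smul]
  gcongr
  exact mul_le_of_le_one_left (norm_nonneg _) hc

/-- Continuous functions on the closed unit polydisc are bounded on the ball. -/
theorem exists_bound_of_continuous {f : (ι → ℂ) → ℂ} (hf : Continuous f) :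
    ∃ C, ∀ᵐ z ∂bergmanMeasure ι lam, ‖f z‖ ≤ C := by
  obtain ⟨C, hC⟩ := (isCompact_closedBall (0 : ι → ℂ) 1).exists_bound_of_continuousOn
    hf.continuousOn
  refine ⟨C, ?_⟩
  filter_upwards [ae_mem_complexBall] with z hz
  refine hC z ?_
  rw [mem_closedBall_zero_iff, pi_norm_le_iff_of_nonneg zero_le_one]
  exact norm_apply_le_one hz

theorem memLp_monomial (hlam : -1 < lam) (α : ι → ℕ) :
    MemLp (monomial α) 2 (bergmanMeasure ι lam) := by
  have := isFiniteMeasure_bergmanMeasure (ι := ι) hlam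
  obtain ⟨C, hC⟩ := exists_bound_of_continuous (lam := lam) (differentiable_monomial α).continuous
  exact MemLp.of_bound (differentiable_monomial α).continuous.aestronglyMeasurable C hC

/-- The monomial `z ^ α` as an element of the Bergman space. -/
noncomputable def monomialVector (hlam : -1 < lam) (α : ι → ℕ) : bergmanSpace ι lam :=
  ⟨(memLp_monomial hlam α).toLp _, monomial α, (differentiable_monomial α).differentiableOn,
    (memLp_monomial hlam α).coeFn_toLp⟩

theorem coeFn_monomialVector (hlam : -1 < lam) (α : ι → ℕ) :
    (monomialVector hlam α : Lp ℂ 2 (bergmanMeasure ι lam)) =ᵐ[bergmanMeasure ι lam] monomial α :=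
  (memLp_monomial hlam α).coeFn_toLp

theorem inner_monomialVector (hlam : -1 < lam) (α : ι → ℕ) (f : Lp ℂ 2 (bergmanMeasure ι lam)) :
    inner ℂ (monomialVector hlam α : Lp ℂ 2 (bergmanMeasure ι lam)) f
      = ∫ z, (starRingEnd ℂ) (monomial α z) * f z ∂bergmanMeasure ι lam := by
  rw [L2.inner_def]
  refine integral_congr_ae ?_
  filter_upwards [coeFn_monomialVector hlam α] with z hz
  rw [hz, RCLike.inner_apply']

theorem eq_zero_of_ae_eq_zero (hlam : -1 < lam) {g : (ι → ℂ) → ℂ}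
    (hg : DifferentiableOn ℂ g (complexBall ι)) (h : g =ᵐ[bergmanMeasure ι lam] 0) {z : ι → ℂ}
    (hz : z ∈ complexBall ι) : g z = 0 := by
  obtain ⟨r, hr, -, C, -, hC⟩ := exists_norm_le_eLpNorm (bergmanConst_pos hlam) hz
  have := hC g hg z (Metric.mem_ball_self hr)
  rw [eLpNorm_congr_ae h, eLpNorm_zero, mul_zero] at this
  simpa using this

theorem monomialVector_ne_zero (hlam : -1 < lam) (α : ι → ℕ) : monomialVector hlam α ≠ 0 := by
  intro h
  have h1 : monomial α =ᵐ[bergmanMeasure ι lam] 0 := by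
    refine (coeFn_monomialVector hlam α).symm.trans ?_
    rw [h]
    exact Lp.coeFn_zero _ _ _
  set r : ℝ := 1 / (Fintype.card ι + 1) with hr
  have hr0 : 0 < r := by positivity
  have hz : (fun _ : ι => (r : ℂ)) ∈ complexBall ι := by
    have hr1 : r * (Fintype.card ι + 1) = 1 := by rw [hr]; field_simp
    show ∑ _i : ι, ‖(r : ℂ)‖ ^ 2 < 1
    have hn : (0 : ℝ) ≤ Fintype.card ι := Nat.cast_nonneg _
    rw [Finset.sum_const, Finset.card_univ, nsmul_eq_mul, Complex.norm_real,
      Real.norm_of_nonneg hr0.le]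
    nlinarith
  have := eq_zero_of_ae_eq_zero hlam (differentiable_monomial α).differentiableOn h1 hz
  rw [monomial, Finset.prod_eq_zero_iff] at this
  obtain ⟨i, -, hi⟩ := this
  exact hr0.ne' (by exact_mod_cast eq_zero_of_pow_eq_zero hi)

/-- A function in the Bergman space that is orthogonal to all monomials vanishes. It suffices that
its homogeneous parts `Q` vanish. Such a `Q`, of degree `d`, is a polynomial, hence orthogonal
to `f`; integrating `conj (Q z) * f (e ^ (i θ) z) * e ^ (-i d θ)` over `z` and `θ` in both orders
then shows that `Q` has norm zero. -/
theorem eq_zero_of_forall_inner_monomialVector (hlam : -1 < lam) {f : bergmanSpace ι lam}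
    (hf : ∀ α, inner ℂ (monomialVector hlam α) f = 0) : f = 0 := by
  classical
  have := isFiniteMeasure_bergmanMeasure (ι := ι) hlam
  set μ := bergmanMeasure ι lam with hμ
  obtain ⟨g, hg, hfg⟩ := f.2
  have h0B : (0 : ι → ℂ) ∈ complexBall ι := by simp [complexBall]
  choose p hp hph using fun d => exists_mvPolynomial_iteratedDeriv isOpen_complexBall h0B d hg
  set Q : ℕ → (ι → ℂ) → ℂ := fun d z => MvPolynomial.eval z (p d) with hQ
  have hQeq : ∀ d z, Q d z = ∑ a ∈ (p d).support, (p d).coeff a * monomial a z := fun d z =>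
    MvPolynomial.eval_eq' z (p d)
  have hQd : ∀ d, Differentiable ℂ (Q d) := fun d => by
    have h : Q d = fun z => ∑ a ∈ (p d).support, (p d).coeff a * monomial a z := funext (hQeq d)
    rw [h]
    exact Differentiable.fun_sum fun a _ => (differentiable_monomial a).const_mul _
  -- a representative measurable everywhere, as the joint measurability on circle times ball needs
  set G : (ι → ℂ) → ℂ := (complexBall ι).indicator g with hG
  have hGm : Measurable G := by
    have := ContinuousOn.measurable_piecewise (g := 0) hg.continuousOn continuousOn_const
      (isOpen_complexBall (ι := ι)).measurableSet
    rwa [Set.piecewise_eq_indicator] at this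
  have hGf : (f : Lp ℂ 2 μ) =ᵐ[μ] G := by
    filter_upwards [hfg, ae_mem_complexBall] with z h1 h2
    rw [h1, hG, Set.indicator_of_mem h2]
  have hGi : Integrable G μ := by
    have h1 : Integrable (f : Lp ℂ 2 μ) μ := (Lp.memLp (f : Lp ℂ 2 μ)).integrable (by norm_num)
    exact h1.congr hGf
  have hmono : ∀ α : ι → ℕ, ∫ z, (starRingEnd ℂ) (monomial α z) * G z ∂μ = 0 := by
    intro α
    rw [← hf α, Submodule.coe_inner, inner_monomialVector]
    refine integral_congr_ae ?_
    filter_upwards [hGf] with z hz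
    rw [hz]
  have hbdd : ∀ h : (ι → ℂ) → ℂ, Continuous h →
      Integrable (fun z => (starRingEnd ℂ) (h z) * G z) μ := by
    intro h hh
    obtain ⟨C, hC⟩ := exists_bound_of_continuous (lam := lam) hh
    refine hGi.bdd_mul (c := C) (Complex.continuous_conj.comp hh).aestronglyMeasurable ?_
    filter_upwards [hC] with z hz
    simpa using hz
  have horth : ∀ d, ∫ z, (starRingEnd ℂ) (Q d z) * G z ∂μ = 0 := by
    intro d
    simp_rw [hQeq, map_sum, map_mul, Finset.sum_mul, mul_assoc]
    rw [integral_finsetSum]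
    · refine Finset.sum_eq_zero fun a _ => ?_
      rw [integral_const_mul, hmono, mul_zero]
    · intro a _
      exact (hbdd _ (differentiable_monomial a).continuous).const_mul _
  have hQ0 : ∀ d, ∀ z ∈ complexBall ι, Q d z = 0 := by
    intro d
    -- the integrand on circle times ball whose two iterated integrals are compared
    set F : ℝ → (ι → ℂ) → ℂ := fun θ z =>
      (circleMap 0 1 θ ^ d)⁻¹ * ((starRingEnd ℂ) (Q d z) * G (circleMap 0 1 θ • z)) with hF
    have hrot : ∀ (θ : ℝ) (H : (ι → ℂ) → ℂ),
        ∫ z, H (circleMap 0 1 θ • z) ∂μ = ∫ z, H z ∂μ := by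
      intro θ H
      have h := integral_rotate (lam := lam) (fun _ : ι => Circle.exp θ) H
      have e : circleMap 0 1 θ = Circle.exp θ := by simp [circleMap, Circle.coe_exp]
      rw [e]
      exact h
    have hconj : ∀ θ z, (starRingEnd ℂ) (Q d (circleMap 0 1 θ • z))
        = (circleMap 0 1 θ ^ d)⁻¹ * (starRingEnd ℂ) (Q d z) := by
      intro θ z
      rw [hQ]
      simp only [hph, map_mul, map_pow]
      congr 1
      rw [← inv_pow, Complex.inv_def]
      simp [Complex.normSq_eq_norm_sq]
    have hFeq : ∀ θ z, F θ z = (starRingEnd ℂ) (Q d (circleMap 0 1 θ • z))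
        * G (circleMap 0 1 θ • z) := by
      intro θ z
      rw [hconj, mul_assoc]
    have hQG := hbdd (Q d) (hQd d).continuous
    have hFθ : ∀ θ, Integrable (F θ) μ := by
      intro θ
      have h := (measurePreserving_rotate (lam := lam)
        (fun _ : ι => Circle.exp θ)).integrable_comp_of_integrable hQG
      refine h.congr (.of_forall fun z => ?_)
      have e : circleMap 0 1 θ = Circle.exp θ := by simp [circleMap, Circle.coe_exp]
      rw [hFeq, e]
      rfl
    have hFm : Measurable (Function.uncurry F) := by
      have hc : Measurable (circleMap 0 1) := (continuous_circleMap 0 1).measurable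
      have h1 : Measurable fun q : ℝ × (ι → ℂ) => circleMap 0 1 q.1 • q.2 :=
        (hc.comp measurable_fst).smul measurable_snd
      have h2 : Measurable fun q : ℝ × (ι → ℂ) => (starRingEnd ℂ) (Q d q.2) :=
        (Complex.continuous_conj.comp (hQd d).continuous).measurable.comp measurable_snd
      exact ((hc.comp measurable_fst).pow_const d).inv.mul (h2.mul (hGm.comp h1))
    have hFi : Integrable (Function.uncurry F)
        ((volume.restrict (Set.Ioc 0 (2 * Real.pi))).prod μ) := by
      rw [integrable_prod_iff hFm.aestronglyMeasurable]
      refine ⟨.of_forall fun θ => hFθ θ, ?_⟩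
      have : ∀ θ, ∫ z, ‖F θ z‖ ∂μ = ∫ z, ‖(starRingEnd ℂ) (Q d z) * G z‖ ∂μ := by
        intro θ
        simp_rw [hFeq]
        have h := hrot θ (fun z => ((‖(starRingEnd ℂ) (Q d z) * G z‖ : ℝ) : ℂ))
        rw [integral_complex_ofReal, integral_complex_ofReal] at h
        exact_mod_cast h
      simp only [Function.uncurry_apply_pair, this]
      exact integrable_const _
    have hswap := integral_integral_swap hFi
    have hL : ∀ θ, ∫ z, F θ z ∂μ = 0 := fun θ => by
      simp_rw [hFeq]
      rw [hrot θ (fun z => (starRingEnd ℂ) (Q d z) * G z), horth]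
    simp only [hL, integral_zero] at hswap
    have hR : ∀ z ∈ complexBall ι, ∫ θ in Set.Ioc 0 (2 * Real.pi), F θ z
        = ((2 * Real.pi / d.factorial * ‖Q d z‖ ^ 2 : ℝ) : ℂ) := by
      intro z hz
      have hdiff : DifferentiableOn ℂ (fun t : ℂ => g (t • z)) (Metric.closedBall 0 1) := by
        intro t ht
        have hm : t • z ∈ complexBall ι := smul_mem_complexBall hz (by simpa using ht)
        exact ((hg.differentiableAt (isOpen_complexBall.mem_nhds hm)).comp t
          (by fun_prop : DifferentiableAt ℂ (fun s : ℂ => s • z) t)).differentiableWithinAt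
      have h1 : ∀ θ, F θ z = (starRingEnd ℂ) (Q d z) *
          ((circleMap 0 1 θ ^ d)⁻¹ * g (circleMap 0 1 θ • z)) := by
        intro θ
        have hm : circleMap 0 1 θ • z ∈ complexBall ι := smul_mem_complexBall hz (by simp)
        rw [hF]
        simp only [hG, Set.indicator_of_mem hm]
        ring
      simp_rw [h1]
      rw [integral_const_mul, integral_circleMap_inv_pow_mul one_pos hdiff d, hp]
      have h2 := Complex.conj_mul' (Q d z)
      push_cast
      rw [← h2]
      simp only [hQ]
      ring
    have hR' : ∫ z, (∫ θ in Set.Ioc 0 (2 * Real.pi), F θ z) ∂μ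
        = ((∫ z, 2 * Real.pi / d.factorial * ‖Q d z‖ ^ 2 ∂μ : ℝ) : ℂ) := by
      rw [← integral_complex_ofReal]
      refine integral_congr_ae ?_
      filter_upwards [ae_mem_complexBall] with z hz
      exact hR z hz
    rw [hR'] at hswap
    have h3 : ∫ z, 2 * Real.pi / d.factorial * ‖Q d z‖ ^ 2 ∂μ = 0 := by exact_mod_cast hswap.symm
    rw [integral_eq_zero_iff_of_nonneg (fun z => by positivity)] at h3
    · intro z hz
      refine eq_zero_of_ae_eq_zero hlam (hQd d).differentiableOn ?_ hz
      filter_upwards [h3] with z hz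
      have h4 : (2 * Real.pi / d.factorial : ℝ) ≠ 0 := by positivity
      simpa [h4, Real.pi_ne_zero, d.factorial_ne_zero] using hz
    · obtain ⟨C, hC⟩ := exists_bound_of_continuous (lam := lam) (hQd d).continuous
      have hc : Continuous fun z => 2 * Real.pi / d.factorial * ‖Q d z‖ ^ 2 :=
        ((hQd d).continuous.norm.pow 2).const_mul _
      refine Integrable.of_bound hc.aestronglyMeasurable (2 * Real.pi / d.factorial * C ^ 2) ?_
      filter_upwards [hC] with z hz
      rw [Real.norm_of_nonneg (by positivity)]
      gcongr
  have hg0 : ∀ z ∈ complexBall ι, g z = 0 := by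
    intro z hz
    obtain ⟨s, hs, hsB⟩ : ∃ s > (1 : ℝ), ∀ t : ℂ, ‖t‖ < s → t • z ∈ complexBall ι := by
      have h1 : Tendsto (fun s : ℝ => ∑ i, (s * ‖z i‖) ^ 2) (𝓝[>] 1) (𝓝 (∑ i, (1 * ‖z i‖) ^ 2)) :=
        ((by fun_prop : Continuous fun s : ℝ => ∑ i, (s * ‖z i‖) ^ 2).tendsto 1).mono_left
          nhdsWithin_le_nhds
      have h2 : ∑ i, (1 * ‖z i‖) ^ 2 < 1 := by simpa [complexBall] using hz
      obtain ⟨s, hs1, hs2⟩ := ((h1.eventually_lt_const h2).and self_mem_nhdsWithin).exists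
      refine ⟨s, hs2, fun t ht => ?_⟩
      show ∑ i, ‖(t • z) i‖ ^ 2 < 1
      refine lt_of_le_of_lt (Finset.sum_le_sum fun i _ => ?_) hs1
      rw [Pi.smul_apply, norm_smul]
      gcongr
    have hdiff : DifferentiableOn ℂ (fun t : ℂ => g (t • z)) (Metric.ball 0 s) := by
      intro t ht
      have hm := hsB t (by simpa using ht)
      exact ((hg.differentiableAt (isOpen_complexBall.mem_nhds hm)).comp t
        (by fun_prop : DifferentiableAt ℂ (fun s : ℂ => s • z) t)).differentiableWithinAt
    have hsum := Complex.hasSum_taylorSeries_on_ball hdiff (z := 1) (by simpa using hs)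
    simp only [hp] at hsum
    have h0 : ∀ d, MvPolynomial.eval z (p d) = 0 := fun d => hQ0 d z hz
    simp only [h0, smul_zero, one_smul] at hsum
    exact hsum.unique hasSum_zero
  apply Subtype.ext
  rw [Lp.ext_iff]
  refine hfg.trans ?_
  filter_upwards [ae_mem_complexBall, Lp.coeFn_zero ℂ 2 μ] with z h1 h2
  rw [hg0 z h1]
  exact h2.symm

end Monomials

/-! ### The orthonormal basis of normalized monomials -/

section Basis

variable {ι : Type} [Fintype ι] {lam : ℝ}

theorem monomial_mul (α : ι → ℕ) (x y : ι → ℂ) :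
    monomial α (fun i => x i * y i) = monomial α x * monomial α y := by
  simp only [monomial, mul_pow, Finset.prod_mul_distrib]

/-- A function picking up a scalar factor `χ ≠ 1` under a rotation has integral zero. -/
theorem integral_eq_zero_of_rotate (θ : ι → Circle) {F : (ι → ℂ) → ℂ} {χ : ℂ} (hχ : χ ≠ 1)
    (h : ∀ᵐ z ∂bergmanMeasure ι lam, F (fun i => θ i * z i) = χ * F z) :
    ∫ z, F z ∂bergmanMeasure ι lam = 0 := by
  have h1 := integral_rotate (lam := lam) θ F
  rw [integral_congr_ae h, integral_const_mul] at h1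
  have h2 : (χ - 1) * ∫ z, F z ∂bergmanMeasure ι lam = 0 := by
    rw [sub_mul, h1, one_mul, sub_self]
  exact (mul_eq_zero.1 h2).resolve_left (sub_ne_zero.2 hχ)

theorem exists_circle_conj_pow_mul_pow {p q : ℕ} (hpq : p ≠ q) :
    ∃ g : Circle, (starRingEnd ℂ) ((g : ℂ) ^ p) * (g : ℂ) ^ q = -1 := by
  refine ⟨Circle.exp (Real.pi / ((q : ℝ) - p)), ?_⟩
  have h : ((q : ℂ) - p) ≠ 0 := sub_ne_zero.2 (by exact_mod_cast hpq.symm)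
  rw [Circle.coe_exp, ← Complex.exp_nat_mul, ← Complex.exp_nat_mul, ← Complex.exp_conj,
    ← Complex.exp_add, ← Complex.exp_pi_mul_I]
  congr 1
  simp only [map_mul, Complex.conj_ofReal, Complex.conj_I, map_natCast]
  push_cast
  field_simp
  ring

/-- The entry of a Toeplitz operator between two monomials vanishes if some rotation preserves
the symbol and acts on the two monomials by different characters. -/
theorem integral_conj_monomial_eq_zero {φ : (ι → ℂ) → ℂ} {α β : ι → ℕ} (θ : ι → Circle)
    (hφ : ∀ᵐ z ∂bergmanMeasure ι lam, φ (fun i => θ i * z i) = φ z)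
    (hθ : (starRingEnd ℂ) (monomial β fun i => (θ i : ℂ)) * monomial α (fun i => (θ i : ℂ)) ≠ 1) :
    ∫ z, (starRingEnd ℂ) (monomial β z) * (φ z * monomial α z) ∂bergmanMeasure ι lam = 0 := by
  refine integral_eq_zero_of_rotate θ hθ ?_
  filter_upwards [hφ] with z hz
  rw [hz, monomial_mul, monomial_mul, map_mul]
  ring

/-- The normalized monomials. -/
noncomputable def unitMonomial (hlam : -1 < lam) (α : ι → ℕ) : bergmanSpace ι lam :=
  ((‖monomialVector hlam α‖⁻¹ : ℝ) : ℂ) • monomialVector hlam α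

theorem inner_monomialVector_monomialVector (hlam : -1 < lam) (α β : ι → ℕ) :
    inner ℂ (monomialVector hlam β) (monomialVector hlam α)
      = ∫ z, (starRingEnd ℂ) (monomial β z) * (1 * monomial α z) ∂bergmanMeasure ι lam := by
  rw [Submodule.coe_inner, inner_monomialVector]
  refine integral_congr_ae ?_
  filter_upwards [coeFn_monomialVector hlam α] with z hz
  rw [hz, one_mul]

theorem exists_rotation_single {α β : ι → ℕ} {i : ι} (hi : α i ≠ β i) : ∃ θ : ι → Circle,
    (∀ l, l ≠ i → θ l = 1) ∧
    (starRingEnd ℂ) (monomial β fun i => (θ i : ℂ)) * monomial α (fun i => (θ i : ℂ)) ≠ 1 := by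
  classical
  obtain ⟨g, hg⟩ := exists_circle_conj_pow_mul_pow hi.symm
  refine ⟨fun l => if l = i then g else 1, fun l hl => if_neg hl, ?_⟩
  have h : ∀ γ : ι → ℕ, monomial γ (fun l => ((if l = i then g else 1 : Circle) : ℂ))
      = (g : ℂ) ^ γ i := by
    intro γ
    rw [monomial, Finset.prod_eq_single i (fun l _ hl => by simp [hl]) (by simp)]
    simp
  rw [h, h, hg]
  norm_num

theorem orthonormal_unitMonomial (hlam : -1 < lam) :
    Orthonormal ℂ (unitMonomial (ι := ι) hlam) := by
  refine ⟨fun α => ?_, fun β α hαβ => ?_⟩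
  · rw [unitMonomial, norm_smul, Complex.norm_real, norm_inv, norm_norm]
    exact inv_mul_cancel₀ (norm_ne_zero_iff.2 (monomialVector_ne_zero hlam α))
  · obtain ⟨i, hi⟩ := Function.ne_iff.1 hαβ.symm
    obtain ⟨θ, -, hθ⟩ := exists_rotation_single hi
    simp only [unitMonomial]
    rw [inner_smul_left (E := bergmanSpace ι lam), inner_smul_right (E := bergmanSpace ι lam),
      inner_monomialVector_monomialVector,
      integral_conj_monomial_eq_zero (φ := fun _ => 1) θ (.of_forall fun _ => rfl) hθ, mul_zero,
      mul_zero]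

theorem eq_of_forall_inner_unitMonomial (hlam : -1 < lam) {f g : bergmanSpace ι lam}
    (h : ∀ α, inner ℂ (unitMonomial hlam α) f = inner ℂ (unitMonomial hlam α) g) : f = g := by
  rw [← sub_eq_zero]
  refine eq_zero_of_forall_inner_monomialVector hlam fun α => ?_
  have h1 := h α
  rw [← sub_eq_zero, ← inner_sub_right (E := bergmanSpace ι lam), unitMonomial,
    inner_smul_left (E := bergmanSpace ι lam)] at h1
  refine (mul_eq_zero.1 h1).resolve_left ?_
  simpa using monomialVector_ne_zero hlam α

theorem dense_span_unitMonomial (hlam : -1 < lam) :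
    Dense (Submodule.span ℂ (Set.range (unitMonomial (ι := ι) hlam)) :
      Set (bergmanSpace ι lam)) := by
  rw [Submodule.dense_iff_topologicalClosure_eq_top, Submodule.topologicalClosure_eq_top_iff,
    Submodule.eq_bot_iff]
  intro f hf
  refine eq_of_forall_inner_unitMonomial hlam fun α => ?_
  rw [inner_zero_right]
  exact (Submodule.mem_orthogonal _ _).1 hf _ (Submodule.subset_span ⟨α, rfl⟩)

end Basis

/-! ### Matrix entries of Toeplitz operators -/

section Entries

variable {ι : Type} [Fintype ι] {lam : ℝ}

theorem inner_toeplitz_monomialVector (hlam : -1 < lam) {φ : (ι → ℂ) → ℂ}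
    (hφ : MemLp φ ∞ (bergmanMeasure ι lam)) (α β : ι → ℕ) :
    inner ℂ (monomialVector hlam β) (toeplitz (hφ.toLp φ) (monomialVector hlam α))
      = ∫ z, (starRingEnd ℂ) (monomial β z) * (φ z * monomial α z) ∂bergmanMeasure ι lam := by
  have h : inner ℂ (monomialVector hlam β) (toeplitz (hφ.toLp φ) (monomialVector hlam α))
      = inner ℂ (monomialVector hlam β : Lp ℂ 2 (bergmanMeasure ι lam))
        ((ContinuousLinearMap.mul ℂ ℂ).holderL (bergmanMeasure ι lam) ∞ 2 2 (hφ.toLp φ)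
          (monomialVector hlam α : Lp ℂ 2 (bergmanMeasure ι lam))) := by
    simp [toeplitz]
  rw [h, inner_monomialVector]
  refine integral_congr_ae ?_
  have h2 := (ContinuousLinearMap.mul ℂ ℂ).coeFn_holder (r := 2) (hφ.toLp φ)
    (monomialVector hlam α : Lp ℂ 2 (bergmanMeasure ι lam))
  filter_upwards [h2, hφ.coeFn_toLp, coeFn_monomialVector hlam α] with z h3 h4 h5
  simp only [ContinuousLinearMap.holderL_apply_apply]
  rw [h3, h4, h5]
  rfl

theorem monomial_smul (α : ι → ℕ) (r : ℝ) (x : ι → ℂ) :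
    monomial α (fun i => r • x i) = (r : ℂ) ^ (∑ i, α i) * monomial α x := by
  simp only [monomial, Complex.real_smul, mul_pow, Finset.prod_mul_distrib,
    Finset.prod_pow_eq_pow_sum]

theorem monomial_eq_mul (p : ι → Prop) [DecidablePred p] (α : ι → ℕ) (z : ι → ℂ) :
    monomial α z = monomial (fun i : {i // p i} => α i) (fun i => z i)
      * monomial (fun i : {i // ¬ p i} => α i) (fun i => z i) :=
  (Fintype.prod_subtype_mul_prod_subtype p fun i => z i ^ α i).symm

/-- The matrix entry of a symbol that depends on the direction of a group of variables only:
it is the product of a factor that involves the symbol and the exponents of that group, and a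
factor that involves their total degree and the other exponents. -/
theorem integral_conj_monomial_mul (hlam : -1 < lam) (p : ι → Prop) [DecidablePred p]
    [Nonempty {i // p i}] {φ : ({i // p i} → ℂ) → ℂ}
    (hφ : ∀ r : ℝ, 0 < r → ∀ x, φ (fun i => r • x i) = φ x) (α β : ι → ℕ) :
    ∫ z, (starRingEnd ℂ) (monomial β z) * (φ (fun i => z i) * monomial α z) ∂bergmanMeasure ι lam
      = sphereIntegral (fun x => (starRingEnd ℂ) (monomial (fun i : {i // p i} => β i) x) *
          (φ x * monomial (fun i : {i // p i} => α i) x)) *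
        radialIntegral {i // p i} (radialWeight ι lam)
          (∑ i : {i // p i}, β i + ∑ i : {i // p i}, α i)
          (fun y => (starRingEnd ℂ) (monomial (fun i : {i // ¬ p i} => β i) y) *
            monomial (fun i : {i // ¬ p i} => α i) y) := by
  rw [integral_bergmanMeasure hlam, ← integral_mul_of_homogeneous p]
  · congr 1
    ext z
    rw [monomial_eq_mul p α, monomial_eq_mul p β, map_mul]
    congr 1
    ring
  · intro r hr x
    rw [hφ r hr, monomial_smul, monomial_smul, map_mul, map_pow, Complex.conj_ofReal, pow_add]
    ring

/-- Normalized matrix entries of a symbol that depends on the direction of a group of variables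
only, between monomials of equal degree in that group and equal exponents in the other
variables, do not depend on the exponents of the other variables. -/
theorem inner_toeplitz_unitMonomial_eq (hlam : -1 < lam) (p : ι → Prop) [DecidablePred p]
    [Nonempty {i // p i}] {φ : ({i // p i} → ℂ) → ℂ}
    (hφ : ∀ r : ℝ, 0 < r → ∀ x, φ (fun i => r • x i) = φ x)
    (hm : MemLp (fun z : ι → ℂ => φ fun i => z i) ∞ (bergmanMeasure ι lam))
    {α β α' β' : ι → ℕ} (hd : ∑ i : {i // p i}, β i = ∑ i : {i // p i}, α i)
    (hα : ∀ i, p i → α' i = α i) (hβ : ∀ i, p i → β' i = β i)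
    (hαβ : ∀ i, ¬ p i → β i = α i) (hαβ' : ∀ i, ¬ p i → β' i = α' i) :
    inner ℂ (unitMonomial hlam β) (toeplitz (hm.toLp _) (unitMonomial hlam α))
      = inner ℂ (unitMonomial hlam β') (toeplitz (hm.toLp _) (unitMonomial hlam α')) := by
  have eα : (fun i : {i // p i} => α' i) = fun i : {i // p i} => α i := funext fun i => hα i i.2
  have eβ : (fun i : {i // p i} => β' i) = fun i : {i // p i} => β i := funext fun i => hβ i i.2
  have e1 : (fun i : {i // ¬ p i} => β i) = fun i : {i // ¬ p i} => α i :=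
    funext fun i => hαβ i i.2
  have e2 : (fun i : {i // ¬ p i} => β' i) = fun i : {i // ¬ p i} => α' i :=
    funext fun i => hαβ' i i.2
  have hone : ∀ r : ℝ, 0 < r → ∀ x : {i // p i} → ℂ, (fun _ => (1 : ℂ)) (fun i => r • x i)
      = (fun _ => (1 : ℂ)) x := fun _ _ _ => rfl
  have hin : ∀ γ : ι → ℕ, ((‖monomialVector hlam γ‖ : ℂ)) ^ 2
      = ∫ z, (starRingEnd ℂ) (monomial γ z) * (1 * monomial γ z) ∂bergmanMeasure ι lam := by
    intro γ
    rw [← inner_monomialVector_monomialVector hlam]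
    exact (inner_self_eq_norm_sq_to_K (𝕜 := ℂ) (monomialVector hlam γ)).symm
  have n0 : ∀ γ : ι → ℕ, (‖monomialVector hlam γ‖ : ℂ) ≠ 0 := fun γ => by
    simpa using monomialVector_ne_zero hlam γ
  -- the factor with the other exponents is common to the entry and to both squared norms
  have hentry : (∫ z, (starRingEnd ℂ) (monomial β z) * (φ (fun i => z i) * monomial α z)
        ∂bergmanMeasure ι lam) * (‖monomialVector hlam α'‖ : ℂ) ^ 2
      = (∫ z, (starRingEnd ℂ) (monomial β' z) * (φ (fun i => z i) * monomial α' z)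
        ∂bergmanMeasure ι lam) * (‖monomialVector hlam α‖ : ℂ) ^ 2 := by
    rw [hin, hin, integral_conj_monomial_mul hlam p hφ, integral_conj_monomial_mul hlam p hφ,
      integral_conj_monomial_mul hlam p (φ := fun _ => 1) hone,
      integral_conj_monomial_mul hlam p (φ := fun _ => 1) hone, eα, eβ, e1,
      e2, hd]
    ring
  have hnorm : ‖monomialVector hlam β‖ * ‖monomialVector hlam α'‖
      = ‖monomialVector hlam β'‖ * ‖monomialVector hlam α‖ := by
    have h : (‖monomialVector hlam β‖ : ℂ) ^ 2 * (‖monomialVector hlam α'‖ : ℂ) ^ 2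
        = (‖monomialVector hlam β'‖ : ℂ) ^ 2 * (‖monomialVector hlam α‖ : ℂ) ^ 2 := by
      rw [hin, hin, hin, hin, integral_conj_monomial_mul hlam p (φ := fun _ => 1) hone,
        integral_conj_monomial_mul hlam p (φ := fun _ => 1) hone,
        integral_conj_monomial_mul hlam p (φ := fun _ => 1) hone,
        integral_conj_monomial_mul hlam p (φ := fun _ => 1) hone, eα, eβ, e1, e2, hd]
      ring
    rw [← mul_pow, ← mul_pow] at h
    exact (pow_left_inj₀ (by positivity) (by positivity) two_ne_zero).1 (by exact_mod_cast h)
  have hnorm' : (‖monomialVector hlam β‖ : ℂ) * ‖monomialVector hlam α'‖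
      = ‖monomialVector hlam β'‖ * ‖monomialVector hlam α‖ := by exact_mod_cast hnorm
  simp only [unitMonomial, map_smul]
  rw [inner_smul_left (E := bergmanSpace ι lam), inner_smul_right (E := bergmanSpace ι lam),
    inner_smul_left (E := bergmanSpace ι lam), inner_smul_right (E := bergmanSpace ι lam)]
  rw [inner_toeplitz_monomialVector, inner_toeplitz_monomialVector]
  generalize (∫ z, (starRingEnd ℂ) (monomial β z) * (φ (fun i => z i) * monomial α z)
    ∂bergmanMeasure ι lam) = I at hentry ⊢
  generalize (∫ z, (starRingEnd ℂ) (monomial β' z) * (φ (fun i => z i) * monomial α' z)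
    ∂bergmanMeasure ι lam) = I' at hentry ⊢
  have k1 := n0 α
  have k2 := n0 β
  have k3 := n0 α'
  have k4 := n0 β'
  simp only [Complex.ofReal_inv, map_inv₀, Complex.conj_ofReal]
  field_simp
  apply mul_right_cancel₀ k1
  linear_combination (‖monomialVector hlam β‖ : ℂ) * hentry
    - I * (‖monomialVector hlam α'‖ : ℂ) * hnorm'

end Entries

/-! ### Symmetries of the symbols -/

section Symmetry

variable {k : ℕ}

theorem PseudoHomogeneous.onSpace_real_smul (c : PseudoHomogeneous k) {r : ℝ} (hr : 0 < r)
    (x : Fin k → ℂ) : c.onSpace (fun l => r • x l) = c.onSpace x := by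
  by_cases hx : x = 0
  · subst hx
    congr 1
    ext l
    simp
  have hx' : (fun l => r • x l) ≠ 0 := fun h => hx (funext fun l => by
    have := congrFun h l
    simpa [hr.ne'] using this)
  have h1 : x ∈ ({0}ᶜ : Set (Fin k → ℂ)) := hx
  have h2 : (fun l => r • x l) ∈ ({0}ᶜ : Set (Fin k → ℂ)) := hx'
  rw [PseudoHomogeneous.onSpace, PseudoHomogeneous.onSpace, dif_pos h1, dif_pos h2]
  congr 1
  · apply Subtype.ext
    funext l
    simp only [direction, norm_smul, mul_pow, ← Finset.mul_sum]
    rw [Real.sqrt_mul (by positivity), Real.sqrt_sq (norm_nonneg r), mul_div_mul_left]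
    exact norm_ne_zero_iff.2 hr.ne'
  · funext l
    rw [Complex.real_smul, Complex.arg_real_mul _ hr]

theorem circle_exp_arg_mul (g : Circle) {w : ℂ} (hw : w ≠ 0) :
    Circle.exp (g * w : ℂ).arg = g * Circle.exp w.arg := by
  have key : ∀ v : ℂ, v ≠ 0 → (Circle.exp v.arg : ℂ) = v / ‖v‖ := fun v hv => by
    have h0 : (‖v‖ : ℂ) ≠ 0 := by simpa using hv
    rw [Circle.coe_exp, eq_div_iff h0, mul_comm]
    exact Complex.norm_mul_exp_arg_mul_I v
  apply Circle.ext
  rw [Circle.coe_mul, key _ (mul_ne_zero g.coe_ne_zero hw), key _ hw, norm_mul, Circle.norm_coe,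
    one_mul, mul_div_assoc]

/-- Invariance of the symbol under the diagonal circle action, away from the coordinate
hyperplanes, where the arguments of the coordinates are conventional. -/
theorem PseudoHomogeneous.onSpace_circle_mul (c : PseudoHomogeneous k) (g : Circle)
    {x : Fin k → ℂ} (hx : ∀ l, x l ≠ 0) : c.onSpace (fun l => g * x l) = c.onSpace x := by
  rcases isEmpty_or_nonempty (Fin k) with hk | ⟨⟨l₀⟩⟩
  · congr 1
    exact Subsingleton.elim _ _
  have h1 : x ∈ ({0}ᶜ : Set (Fin k → ℂ)) := fun h => hx l₀ (congrFun h l₀)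
  have h2 : (fun l => (g : ℂ) * x l) ∈ ({0}ᶜ : Set (Fin k → ℂ)) := fun h =>
    mul_ne_zero g.coe_ne_zero (hx l₀) (congrFun h l₀)
  rw [PseudoHomogeneous.onSpace, PseudoHomogeneous.onSpace, dif_pos h1, dif_pos h2,
    ← c.invariant (direction x h1) _ g]
  congr 1
  · apply Subtype.ext
    funext l
    simp only [direction, norm_mul, Circle.norm_coe, one_mul]
  · funext l
    exact circle_exp_arg_mul g (hx l)

theorem ae_forall_apply_ne_zero {ι : Type} [Fintype ι] {lam : ℝ} :
    ∀ᵐ z ∂bergmanMeasure ι lam, ∀ i, z i ≠ 0 := by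
  refine ae_all_iff.2 fun i => ?_
  have h : ∀ᵐ z : ι → ℂ, z i ≠ 0 := Measure.ae_eval_ne (fun _ : ι => (volume : Measure ℂ)) i 0
  exact (withDensity_absolutelyContinuous _ _).ae_le (ae_restrict_of_ae h)

end Symmetry

/-! ### The Toeplitz operators as ampliations -/

section Ampliation

variable {m : ℕ} {k : Fin m → ℕ} {lam : ℝ}

/-- The normalized monomials, indexed by tuples of multi-indices, one for each group of
variables. -/
noncomputable def blockMonomial (hlam : -1 < lam) (α : ∀ j, Fin (k j) → ℕ) :
    bergmanSpace (Σ j, Fin (k j)) lam :=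
  unitMonomial hlam fun i => α i.1 i.2

theorem uncurry_injective :
    Function.Injective fun (α : ∀ j, Fin (k j) → ℕ) (i : Σ j, Fin (k j)) => α i.1 i.2 :=
  fun _ _ h => funext fun j => funext fun l => congrFun h ⟨j, l⟩

theorem orthonormal_blockMonomial (hlam : -1 < lam) :
    Orthonormal ℂ (blockMonomial (k := k) hlam) :=
  (orthonormal_unitMonomial hlam).comp _ uncurry_injective

theorem dense_span_blockMonomial (hlam : -1 < lam) :
    Dense (Submodule.span ℂ (Set.range (blockMonomial (k := k) hlam)) :
      Set (bergmanSpace (Σ j, Fin (k j)) lam)) := by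
  have h : Set.range (blockMonomial (k := k) hlam)
      = Set.range (unitMonomial (ι := Σ j, Fin (k j)) hlam) := by
    refine Set.Subset.antisymm ?_ ?_
    · rintro _ ⟨α, rfl⟩
      exact ⟨_, rfl⟩
    · rintro _ ⟨α, rfl⟩
      exact ⟨fun j l => α ⟨j, l⟩, rfl⟩
  rw [h]
  exact dense_span_unitMonomial hlam

theorem inner_symbolToeplitz_eq_zero (hlam : -1 < lam) (c : ∀ j, PseudoHomogeneous (k j))
    (j : Fin m) {α β : (Σ j, Fin (k j)) → ℕ} (θ : (Σ j, Fin (k j)) → Circle)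
    (hθc : ∀ᵐ z ∂bergmanMeasure (Σ j, Fin (k j)) lam,
      (c j).onSpace (fun l => θ ⟨j, l⟩ * z ⟨j, l⟩) = (c j).onSpace fun l => z ⟨j, l⟩)
    (hθ : (starRingEnd ℂ) (monomial β fun i => (θ i : ℂ)) * monomial α (fun i => (θ i : ℂ)) ≠ 1) :
    inner ℂ (unitMonomial hlam β) (symbolToeplitz c lam j (unitMonomial hlam α)) = 0 := by
  have h : inner ℂ (monomialVector hlam β) (symbolToeplitz c lam j (monomialVector hlam α)) = 0 :=
    (inner_toeplitz_monomialVector hlam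
      ((c j).memLp_comp lam fun l => (⟨j, l⟩ : Σ j, Fin (k j))) α β).trans
      (integral_conj_monomial_eq_zero
        (φ := fun z : (Σ j, Fin (k j)) → ℂ => (c j).onSpace fun l => z ⟨j, l⟩) θ hθc hθ)
  simp only [unitMonomial, map_smul]
  rw [inner_smul_left (E := bergmanSpace (Σ j, Fin (k j)) lam),
    inner_smul_right (E := bergmanSpace (Σ j, Fin (k j)) lam), h, mul_zero, mul_zero]

/-- The rotations of the variables of one of the other groups leave the symbol unchanged. -/
theorem inner_symbolToeplitz_eq_zero_of_ne (hlam : -1 < lam) (c : ∀ j, PseudoHomogeneous (k j))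
    {j : Fin m} {α β : (Σ j, Fin (k j)) → ℕ} {i : Σ j, Fin (k j)} (hi : i.1 ≠ j)
    (h : α i ≠ β i) :
    inner ℂ (unitMonomial hlam β) (symbolToeplitz c lam j (unitMonomial hlam α)) = 0 := by
  obtain ⟨θ, hθ1, hθ⟩ := exists_rotation_single h
  refine inner_symbolToeplitz_eq_zero hlam c j θ (.of_forall fun z => ?_) hθ
  have : ∀ l, θ ⟨j, l⟩ = 1 := fun l => hθ1 _ fun e => hi (by rw [← e])
  simp [this]

/-- The joint rotations of the variables of the group leave the symbol unchanged. -/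
theorem inner_symbolToeplitz_eq_zero_of_degree_ne (hlam : -1 < lam)
    (c : ∀ j, PseudoHomogeneous (k j)) {j : Fin m} {α β : (Σ j, Fin (k j)) → ℕ}
    (h : ∑ l, β ⟨j, l⟩ ≠ ∑ l, α ⟨j, l⟩) :
    inner ℂ (unitMonomial hlam β) (symbolToeplitz c lam j (unitMonomial hlam α)) = 0 := by
  obtain ⟨g, hg⟩ := exists_circle_conj_pow_mul_pow h
  refine inner_symbolToeplitz_eq_zero hlam c j (fun i => if i.1 = j then g else 1) ?_ ?_
  · filter_upwards [ae_forall_apply_ne_zero] with z hz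
    simp only [if_true]
    exact (c j).onSpace_circle_mul g fun l => hz _
  · have key : ∀ γ : (Σ j, Fin (k j)) → ℕ,
        monomial γ (fun i => ((if i.1 = j then g else 1 : Circle) : ℂ))
          = (g : ℂ) ^ ∑ l, γ ⟨j, l⟩ := by
      intro γ
      rw [monomial, Fintype.prod_sigma, Finset.prod_eq_single j, ← Finset.prod_pow_eq_pow_sum]
      · simp
      · intro j' _ hj'
        simp [hj']
      · simp
    rw [key, key, hg]
    norm_num

theorem sum_subtype_fst_eq (j : Fin m) (β : (Σ j, Fin (k j)) → ℕ) :
    ∑ i : {i : Σ j, Fin (k j) // i.1 = j}, β i = ∑ l, β ⟨j, l⟩ :=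
  (Equiv.sum_comp (Equiv.sigmaSubtype j).symm
    fun i : {i : Σ j, Fin (k j) // i.1 = j} => β i).symm

/-- In the basis of normalized monomials `T_{c_j}` acts on the exponents of the `j`-th group of
variables only, through a matrix that does not depend on the other exponents: this gives the
tensor product structure. -/
theorem exists_isAmpliation_symbolToeplitz (hk : ∀ j, 0 < k j) (hlam : -1 < lam)
    (c : ∀ j, PseudoHomogeneous (k j)) (j : Fin m) :
    ∃ T, IsAmpliation (blockMonomial hlam) j T (symbolToeplitz c lam j) := by
  classical
  set S := symbolToeplitz c lam j with hS
  set b := blockMonomial (k := k) hlam with hb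
  have hbo : Orthonormal ℂ b := orthonormal_blockMonomial hlam
  -- the matrix, read off where the exponents of the other groups are zero
  let M : (Fin (k j) → ℕ) → (Fin (k j) → ℕ) → ℂ := fun a' a =>
    inner ℂ (b (Function.update 0 j a')) (S (b (Function.update 0 j a)))
  refine ⟨Finsupp.linearCombination ℂ fun a =>
    ∑ a' ∈ Finset.piAntidiag Finset.univ (∑ l, a l), Finsupp.single a' (M a' a), fun α => ?_⟩
  refine eq_of_forall_inner_unitMonomial hlam fun β' => ?_
  obtain ⟨β, rfl⟩ : ∃ β : ∀ j, Fin (k j) → ℕ, (fun i => β i.1 i.2) = β' :=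
    ⟨fun j l => β' ⟨j, l⟩, rfl⟩
  have hR : inner ℂ (b β) (insertFactor b j α (Finsupp.linearCombination ℂ (fun a =>
      ∑ a' ∈ Finset.piAntidiag Finset.univ (∑ l, a l), Finsupp.single a' (M a' a))
        (Finsupp.single (α j) 1)))
      = ∑ a' ∈ Finset.piAntidiag Finset.univ (∑ l, α j l),
        if β = Function.update α j a' then M a' (α j) else 0 := by
    rw [Finsupp.linearCombination_single, one_smul, map_sum,
      inner_sum (E := bergmanSpace (Σ j, Fin (k j)) lam)]
    refine Finset.sum_congr rfl fun a' _ => ?_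
    rw [insertFactor, Finsupp.linearCombination_single,
      inner_smul_right (E := bergmanSpace (Σ j, Fin (k j)) lam),
      orthonormal_iff_ite.1 hbo, mul_ite, mul_one, mul_zero]
  refine Eq.trans ?_ hR.symm
  by_cases h1 : ∀ i ≠ j, β i = α i
  · have hβ : β = Function.update α j (β j) := by
      funext i
      by_cases hi : i = j
      · subst hi; simp
      · rw [Function.update_of_ne hi, h1 i hi]
    have hiff : ∀ a', β = Function.update α j a' ↔ β j = a' := fun a' =>
      ⟨fun h => by rw [h, Function.update_self], fun h => by rw [← h]; exact hβ⟩
    simp_rw [hiff]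
    rw [Finset.sum_ite_eq]
    by_cases h2 : ∑ l, β j l = ∑ l, α j l
    · rw [if_pos (by simpa [Finset.mem_piAntidiag] using h2)]
      have : Nonempty {i : Σ j, Fin (k j) // i.1 = j} := ⟨⟨⟨j, ⟨0, hk j⟩⟩, rfl⟩⟩
      refine inner_toeplitz_unitMonomial_eq hlam (fun i : Σ j, Fin (k j) => i.1 = j)
        (φ := fun x => (c j).onSpace fun l => x ⟨⟨j, l⟩, rfl⟩)
        (fun r hr x => (c j).onSpace_real_smul hr _) _ ?_ ?_ ?_ ?_ ?_
      · rw [sum_subtype_fst_eq j (fun i => β i.1 i.2), sum_subtype_fst_eq j (fun i => α i.1 i.2)]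
        exact h2
      · rintro ⟨i, l⟩ rfl
        simp
      · rintro ⟨i, l⟩ rfl
        simp
      · rintro ⟨i, l⟩ hi
        exact congrFun (h1 i hi) l
      · rintro ⟨i, l⟩ hi
        have hi' : i ≠ j := hi
        simp [hi']
    · rw [if_neg (by simpa [Finset.mem_piAntidiag] using h2)]
      exact inner_symbolToeplitz_eq_zero_of_degree_ne hlam c h2
  · push Not at h1
    obtain ⟨i, hi, hne⟩ := h1
    obtain ⟨l, hl⟩ := Function.ne_iff.1 hne
    rw [Finset.sum_eq_zero]
    · exact inner_symbolToeplitz_eq_zero_of_ne hlam c (i := ⟨i, l⟩) hi (Ne.symm hl)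
    · intro a' _
      rw [if_neg]
      intro h
      exact hne (by rw [h, Function.update_of_ne hi])

end Ampliation

/-! ### The maximal ideal spaces -/

section Joint

variable {B : Type} [NormedRing B] [NormedAlgebra ℂ B]

theorem topologicalClosure_adjoin_iUnion {ι : Type} (s : ι → B) :
    (Algebra.adjoin ℂ
      (⋃ i, ((Algebra.adjoin ℂ {s i}).topologicalClosure : Set B))).topologicalClosure
      = (Algebra.adjoin ℂ (Set.range s)).topologicalClosure := by
  refine le_antisymm ?_ ?_
  · refine Subalgebra.topologicalClosure_minimal
      (Algebra.adjoin_le (Set.iUnion_subset fun i => ?_)) (Subalgebra.isClosed_topologicalClosure _)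
    exact Subalgebra.topologicalClosure_mono
      (Algebra.adjoin_mono (Set.singleton_subset_iff.2 (Set.mem_range_self i)))
  · refine Subalgebra.topologicalClosure_mono (Algebra.adjoin_mono ?_)
    rintro _ ⟨i, rfl⟩
    exact Set.mem_iUnion.2
      ⟨i, Subalgebra.le_topologicalClosure _ (Algebra.subset_adjoin rfl)⟩

/-- The restriction of a character to a smaller algebra. -/
noncomputable def restrictCharacter {A A' : Subalgebra ℂ B} (h : A ≤ A')
    (ψ : WeakDual.characterSpace ℂ A') : WeakDual.characterSpace ℂ A :=
  ⟨(WeakDual.CharacterSpace.toCLM ψ).comp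
      ⟨(Subalgebra.inclusion h).toLinearMap, by
        exact continuous_inclusion (s := (A : Set B)) (t := (A' : Set B)) h⟩, by
    rw [WeakDual.CharacterSpace.eq_set_map_one_map_mul]
    exact ⟨map_one ψ, fun x y => map_mul ψ (Subalgebra.inclusion h x) (Subalgebra.inclusion h y)⟩⟩

end Joint

/-- A product of homeomorphisms onto sets of complex numbers, as a homeomorphism onto the product
of these sets. -/
noncomputable def homeomorphPi {ι : Type} {M : ι → Type} [∀ i, TopologicalSpace (M i)]
    {X : ι → Set ℂ} (Θ : ∀ i, M i ≃ₜ X i) : (∀ i, M i) ≃ₜ (Set.univ.pi X : Set (ι → ℂ)) where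
  toFun x := ⟨fun i => (Θ i (x i) : ℂ), fun i _ => (Θ i (x i)).2⟩
  invFun y i := (Θ i).symm ⟨(y : ι → ℂ) i, y.2 i (Set.mem_univ i)⟩
  left_inv x := by ext i; simp
  right_inv y := by ext i; simp
  continuous_toFun := by fun_prop
  continuous_invFun := by
    refine continuous_pi fun i => (Θ i).symm.continuous.comp (Continuous.subtype_mk ?_ _)
    exact (continuous_apply i).comp continuous_subtype_val

/-- The joint maximal ideal space of commuting elements `s i` of a Banach algebra is the product of
the maximal ideal spaces of the algebras generated by the single elements, and also of the
polynomially convex hulls of their spectra, provided that every point of the product of the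
frontiers of the spectra gives a contractive evaluation of the polynomials in the `s i`. -/
theorem exists_homeomorph_characterSpace_pi {B : Type} [NormedRing B] [NormedAlgebra ℂ B]
    [CompleteSpace B] [NormOneClass B] {ι : Type} [Fintype ι] {s : ι → B}
    (hcomm : ∀ i j, s i * s j = s j * s i)
    (hfr : ∀ ζ : ι → ℂ, (∀ i, ζ i ∈ frontier (spectrum ℂ (s i))) → ∀ P : FreeAlgebra ℂ ι,
      ‖FreeAlgebra.lift ℂ ζ P‖ ≤ ‖FreeAlgebra.lift ℂ s P‖)
    {A : ι → Subalgebra ℂ B} (hA : ∀ i, A i = (Algebra.adjoin ℂ {s i}).topologicalClosure)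
    {J : Subalgebra ℂ B} (hJ : J = (Algebra.adjoin ℂ (Set.range s)).topologicalClosure)
    (hle : ∀ i, A i ≤ J) (hs : ∀ i, s i ∈ A i) :
    (∃ Φ : WeakDual.characterSpace ℂ J ≃ₜ (∀ i, WeakDual.characterSpace ℂ (A i)),
      ∀ ψ i (a : A i), Φ ψ i a = ψ (Subalgebra.inclusion (hle i) a)) ∧
    (∀ i, ∃ Θ : WeakDual.characterSpace ℂ (A i) ≃ₜ polyHull (spectrum ℂ (s i)),
      ∀ ψ, (Θ ψ : ℂ) = ψ ⟨s i, hs i⟩) ∧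
    (∃ Ψ : WeakDual.characterSpace ℂ J ≃ₜ
        (Set.univ.pi fun i => polyHull (spectrum ℂ (s i)) : Set (ι → ℂ)),
      ∀ ψ i, (Ψ ψ : ι → ℂ) i = ψ (Subalgebra.inclusion (hle i) ⟨s i, hs i⟩)) := by
  have := completeSpace_of_eq_topologicalClosure hJ
  have : Nontrivial B := NormOneClass.nontrivial
  obtain ⟨Ψ, hΨ⟩ := exists_homeomorph_characterSpace hJ hcomm
    (X := Set.univ.pi fun i => polyHull (spectrum ℂ (s i)))
    (fun ψ i _ => character_apply_mem_polyHull ψ ⟨s i, _⟩)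
    (fun ζ hζ P => norm_lift_le_of_mem_polyHull (fun i => spectrum.isCompact (s i))
      (fun ξ hξ => hfr ξ hξ P) (fun i => hζ i (Set.mem_univ i)))
  choose Θ hΘ using fun i => exists_homeomorph_characterSpace_singleton (s i) (hA i) (hs i)
  refine ⟨⟨Ψ.trans (homeomorphPi Θ).symm, fun ψ i a => ?_⟩, fun i => ⟨Θ i, hΘ i⟩, ⟨Ψ, hΨ⟩⟩
  -- both are characters of `A i` with the same value at the generator
  have key : (Ψ.trans (homeomorphPi Θ).symm) ψ i = restrictCharacter (hle i) ψ := by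
    apply (Θ i).injective
    apply Subtype.ext
    rw [hΘ i (restrictCharacter _ ψ)]
    refine Eq.trans ?_ (hΨ ψ i)
    exact congrArg Subtype.val ((Θ i).apply_symm_apply _)
  rw [key]
  rfl

/-- The form that `exists_homeomorph_characterSpace_pi` takes for bounded operators. -/
theorem exists_homeomorph_characterSpace_banachAlg {E : Type} [NormedAddCommGroup E]
    [NormedSpace ℂ E] [CompleteSpace E] [Nontrivial E] {ι : Type} [Fintype ι] {S : ι → E →L[ℂ] E}
    (hcomm : ∀ i j, S i * S j = S j * S i)
    (hfr : ∀ ζ : ι → ℂ, (∀ i, ζ i ∈ frontier (spectrum ℂ (S i))) → ∀ P : FreeAlgebra ℂ ι,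
      ‖FreeAlgebra.lift ℂ ζ P‖ ≤ ‖FreeAlgebra.lift ℂ S P‖)
    {A : ι → Subalgebra ℂ (E →L[ℂ] E)} (hA : ∀ i, A i = banachAlg {S i})
    {J : Subalgebra ℂ (E →L[ℂ] E)} (hJ : J = banachAlg (⋃ i, (A i : Set (E →L[ℂ] E))))
    (hle : ∀ i, A i ≤ J) (hs : ∀ i, S i ∈ A i) :
    (∀ a ∈ J, ∀ a' ∈ J, a * a' = a' * a) ∧
    (∃ Φ : maxIdealSpace J ≃ₜ (∀ i, maxIdealSpace (A i)),
      ∀ ψ i (a : A i), Φ ψ i a = ψ (Subalgebra.inclusion (hle i) a)) ∧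
    (∀ i, ∃ Θ : maxIdealSpace (A i) ≃ₜ polyHull (spectrum ℂ (S i)),
      ∀ ψ, (Θ ψ : ℂ) = ψ ⟨S i, hs i⟩) ∧
    (∃ Ψ : maxIdealSpace J ≃ₜ (Set.univ.pi fun i => polyHull (spectrum ℂ (S i)) : Set (ι → ℂ)),
      ∀ ψ i, (Ψ ψ : ι → ℂ) i = ψ (Subalgebra.inclusion (hle i) ⟨S i, hs i⟩)) := by
  have hJ' : J = (Algebra.adjoin ℂ (Set.range S)).topologicalClosure := by
    rw [hJ, ← topologicalClosure_adjoin_iUnion S]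
    simp_rw [hA]
    rfl
  exact ⟨fun a ha a' ha' => mul_comm_of_eq_topologicalClosure hJ' hcomm ha ha',
    exists_homeomorph_characterSpace_pi hcomm hfr hA hJ' hle hs⟩

section Toeplitz

variable {m : ℕ} {k : Fin m → ℕ} {lam : ℝ}

theorem symbolToeplitz_commute (hk : ∀ j, 0 < k j) (hlam : -1 < lam)
    (c : ∀ j, PseudoHomogeneous (k j)) (i j : Fin m) :
    symbolToeplitz c lam i * symbolToeplitz c lam j
      = symbolToeplitz c lam j * symbolToeplitz c lam i := by
  by_cases hij : i = j
  · rw [hij]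
  obtain ⟨T, hT⟩ := exists_isAmpliation_symbolToeplitz hk hlam c i
  obtain ⟨T', hT'⟩ := exists_isAmpliation_symbolToeplitz hk hlam c j
  exact hT'.commute hij hT (dense_span_blockMonomial hlam)

theorem norm_lift_le_norm_lift_symbolToeplitz (hk : ∀ j, 0 < k j) (hlam : -1 < lam)
    (c : ∀ j, PseudoHomogeneous (k j)) {ζ : Fin m → ℂ}
    (hζ : ∀ j, ζ j ∈ frontier (spectrum ℂ (symbolToeplitz c lam j)))
    (P : FreeAlgebra ℂ (Fin m)) :
    ‖FreeAlgebra.lift ℂ ζ P‖ ≤ ‖FreeAlgebra.lift ℂ (symbolToeplitz c lam) P‖ := by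
  have : ∀ j, Nonempty (Fin (k j) → ℕ) := fun j => ⟨0⟩
  choose T hT using exists_isAmpliation_symbolToeplitz hk hlam c
  exact norm_lift_le_of_mem_frontier_spectrum hT (orthonormal_blockMonomial hlam)
    (dense_span_blockMonomial hlam) hζ P

end Toeplitz

end BergmanToeplitz

theorem mainTheorem6 {m : ℕ} (k : Fin m → ℕ) (hk : ∀ j, 0 < k j) (lam : ℝ) (hlam : -1 < lam)
    (c : ∀ j, BergmanToeplitz.PseudoHomogeneous (k j))
    (hc : ∀ j, ∀ ζ ∈ BergmanToeplitz.essentialSpectrum (c j).blockToeplitz,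
      ∃ g : ℕ → BergmanToeplitz.bergmanSpace (Fin (k j)) 0,
        (∀ d, g d ∈ BergmanToeplitz.homogeneousSubspace (Fin (k j)) 0 d ∧ ‖g d‖ = 1) ∧
        Tendsto (fun d => ‖(c j).blockToeplitz (g d) - ζ • g d‖) atTop (𝓝 0)) :
    (∀ S ∈ BergmanToeplitz.jointAlg c lam, ∀ T ∈ BergmanToeplitz.jointAlg c lam,
      S * T = T * S) ∧
    (∃ Φ : BergmanToeplitz.maxIdealSpace (BergmanToeplitz.jointAlg c lam) ≃ₜ
        (∀ j, BergmanToeplitz.maxIdealSpace (BergmanToeplitz.singleAlg c lam j)),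
      ∀ ψ j (T : BergmanToeplitz.singleAlg c lam j),
        Φ ψ j T = ψ (Subalgebra.inclusion (BergmanToeplitz.singleAlg_le_jointAlg c lam j) T)) ∧
    (∀ j, ∃ Θ : BergmanToeplitz.maxIdealSpace (BergmanToeplitz.singleAlg c lam j) ≃ₜ
        BergmanToeplitz.polyHull (spectrum ℂ (BergmanToeplitz.symbolToeplitz c lam j)),
      ∀ ψ, (Θ ψ : ℂ) = ψ (BergmanToeplitz.singleGen c lam j)) ∧
    (∃ Ψ : BergmanToeplitz.maxIdealSpace (BergmanToeplitz.jointAlg c lam) ≃ₜ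
        (Set.univ.pi fun j =>
          BergmanToeplitz.polyHull (spectrum ℂ (BergmanToeplitz.symbolToeplitz c lam j)) :
            Set (Fin m → ℂ)),
      ∀ ψ j, (Ψ ψ : Fin m → ℂ) j = ψ (Subalgebra.inclusion
        (BergmanToeplitz.singleAlg_le_jointAlg c lam j) (BergmanToeplitz.singleGen c lam j))) := by
  have : Nontrivial (BergmanToeplitz.bergmanSpace (Σ j, Fin (k j)) lam) :=
    ⟨⟨_, 0, BergmanToeplitz.monomialVector_ne_zero hlam 0⟩⟩
  exact BergmanToeplitz.exists_homeomorph_characterSpace_banachAlg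
    (BergmanToeplitz.symbolToeplitz_commute hk hlam c)
    (fun _ hζ P => BergmanToeplitz.norm_lift_le_norm_lift_symbolToeplitz hk hlam c hζ P)
    (fun _ => rfl) rfl (BergmanToeplitz.singleAlg_le_jointAlg c lam)
    (fun j => BergmanToeplitz.subset_banachAlg _ rfl)
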